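/- Conventions. For an ideal $I$ of a Noetherian ring $A$, $\operatorname{grade} I$ is the supremum of the lengths of the $A$-regular sequences contained in $I$ if $I\neq A$, and $\operatorname{grade} A=\infty$. For a finitely generated $A$-module $M$, $\operatorname{grade} M=\operatorname{grade}(\operatorname{ann} M)$. An ideal $I$ is perfect of grade $2$ if $\operatorname{pd}_A(A/I)=\operatorname{grade} I=2$. An $A$-module $M$ has rank $e$ if $M\otimes_A Q\cong Q^e$, where $Q$ is the total ring of fractions of $A$. Let $(R,\mathfrak m)$ be a Noetherian local ring and let $E$ be an ideal module of rank $e\ge 2$; that is, $E$ is a finitely generated $R$-module of rank $e$ which embeds in a finitely generated free module $G$ with $\operatorname{grade}(G/E)\ge 2$ (the case $E=G$ is allowed). Let $U\subseteq E$ be a reduction of $E$; that is, $\mathcal R(E)_{r+1}=U\cdot\mathcal R(E)_r$ for some $r\ge 0$, where the Rees algebra $\mathcal R(E)$ is the symmetric algebra of $E$ modulo its $R$-torsion. For generators $a_1,\dots,a_n$ of $U$ and $n(e-1)$ indeterminates $\mathbf Z=(z_{ij})$, $1\le i\le n$, $1\le j\le e-1$, put $R''=R(\mathbf Z)=R[\mathbf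 Z]_{\mathfrak m R[\mathbf Z]}$, $E''=E\otimes_R R''$, $x_j=\sum_{i=1}^n z_{ij}a_i\in E''$ and $F=\sum_{j=1}^{e-1}R''x_j$. An ideal $I$ of $R''$ with $I\cong E''/F$ as $R''$-modules is called a generic Bourbaki ideal of $E$ with respect to $U$; it is called good if $\operatorname{grade} I\ge 2$. Then the following are equivalent: 1. $\operatorname{pd}_R E=1$. 2. Every good generic Bourbaki ideal of $E$ with respect to $U$ (for any choice of finite generating family of $U$) is perfect of grade $2$. 3. There exists a generic Bourbaki ideal of $E$ with respect to $U$ (for some choice of finite generating family of $U$) which is perfect of grade $2$. -/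

import Mathlib

open scoped TensorProduct nonZeroDivisors

universe u

noncomputable section

namespace Bourbaki

/-! ### Grade, perfect ideals, rank, ideal modules -/

section Basic

variable {R : Type u} [CommRing R]

/-- The grade of an ideal `I` of a Noetherian ring: the supremum of the lengths of the sequences
of elements of `I` that are regular on `R`.  A weakly regular sequence contained in a proper
ideal is regular, so for `I ≠ R` this is the usual grade; for `I = R` the sequences
`1, 0, …, 0` give the usual convention `grade R = ∞`. -/
def grade (I : Ideal R) : ℕ∞ :=
  ⨆ (rs : List R) (_ : (∀ r ∈ rs, r ∈ I) ∧ RingTheory.Sequence.IsWeaklyRegular R rs),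
    (rs.length : ℕ∞)

/-- The grade of a finitely generated module: the grade of its annihilator
(so the zero module has grade `∞`). -/
def moduleGrade (R : Type u) [CommRing R] (M : Type u) [AddCommGroup M] [Module R M] : ℕ∞ :=
  grade (Module.annihilator R M)

/-- The projective dimension of a module, with value `⊥` for the zero module. -/
def projDim (R : Type u) [CommRing R] (M : Type u) [AddCommGroup M] [Module R M] :
    WithBot ℕ∞ :=
  CategoryTheory.projectiveDimension (ModuleCat.of R M)

/-- An ideal `I` is perfect if `pd (R/I) = grade I`. -/
def IsPerfect (I : Ideal R) : Prop :=
  projDim R (R ⧸ I) = (grade I : WithBot ℕ∞)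

/-- `E` has rank `e`: `E ⊗ Q ≅ Q ^ e`, where `Q` is the total ring of fractions of `R`. -/
def HasRank (R : Type u) [CommRing R] (E : Type u) [AddCommGroup E] [Module R E] (e : ℕ) :
    Prop :=
  Nonempty ((FractionRing R ⊗[R] E) ≃ₗ[FractionRing R] (Fin e → FractionRing R))

/-- `E` is an ideal module: it is finitely generated and embeds into a finitely generated free
module `G` with `grade (G/E) ≥ 2` (in particular, `E` is torsionfree). -/
def IsIdealModule (R : Type u) [CommRing R] (E : Type u) [AddCommGroup E] [Module R E] :
    Prop :=
  Module.Finite R E ∧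
    ∃ (n : ℕ) (f : E →ₗ[R] (Fin n → R)), Function.Injective f ∧
      2 ≤ moduleGrade R ((Fin n → R) ⧸ LinearMap.range f)

end Basic

/-! ### The Rees algebra of a module and reductions -/

section Rees

variable (R : Type u) [CommRing R] (E : Type u) [AddCommGroup E] [Module R E]

/-- The `R`-torsion of the symmetric algebra of `E`, as an ideal: the elements killed by some
nonzerodivisor of `R`. -/
def symTorsion : Ideal (SymmetricAlgebra R E) where
  carrier := Submodule.torsion R (SymmetricAlgebra R E)
  add_mem' := fun ha hb => add_mem ha hb
  zero_mem' := zero_mem _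
  smul_mem' := by
    rintro c x ⟨a, ha⟩
    refine ⟨a, ?_⟩
    have h : (a : R) • x = 0 := ha
    change (a : R) • (c * x) = 0
    rw [← mul_smul_comm, h, mul_zero]

/-- The Rees algebra of `E`: the symmetric algebra modulo its `R`-torsion. -/
abbrev ReesAlg : Type u := SymmetricAlgebra R E ⧸ symTorsion R E

/-- The natural map from `E` to (the degree one part of) its Rees algebra. -/
def toRees : E →ₗ[R] ReesAlg R E :=
  (Ideal.Quotient.mkₐ R (symTorsion R E)).toLinearMap ∘ₗ SymmetricAlgebra.ι R E

variable {R E}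

/-- `U` is a reduction of `E`: for some `r`, the degree `r + 1` part of the Rees algebra of `E`
is `U` times its degree `r` part.  As the Rees algebra is generated in degree one, its degree `r`
part is the `r`-th power of the image of `E`. -/
def IsReduction (U : Submodule R E) : Prop :=
  ∃ r : ℕ, LinearMap.range (toRees R E) ^ (r + 1) =
    U.map (toRees R E) * LinearMap.range (toRees R E) ^ r

end Rees

/-! ### Nagata extensions and generic Bourbaki ideals -/

section Generic

variable (R : Type u) [CommRing R] [IsLocalRing R]

/-- The extension `𝔪R[Z]` of the maximal ideal `𝔪` of `R` to the polynomial ring `R[Z]`. -/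
def extIdeal (σ : Type) : Ideal (MvPolynomial σ R) :=
  (IsLocalRing.maximalIdeal R).map MvPolynomial.C

instance extIdeal_isPrime (σ : Type) : (extIdeal R σ).IsPrime := by
  have h : extIdeal R σ = RingHom.ker (MvPolynomial.map (σ := σ) (IsLocalRing.residue R)) := by
    rw [MvPolynomial.ker_map, IsLocalRing.ker_residue]
    rfl
  rw [h]
  exact RingHom.ker_isPrime _

/-- The Nagata extension `R(Z) = R[Z]_{𝔪R[Z]}`. -/
def Nagata (σ : Type) : Type u := Localization.AtPrime (extIdeal R σ)

instance (σ : Type) : CommRing (Nagata R σ) :=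
  inferInstanceAs (CommRing (Localization.AtPrime (extIdeal R σ)))

instance (σ : Type) : Algebra (MvPolynomial σ R) (Nagata R σ) :=
  inferInstanceAs (Algebra (MvPolynomial σ R) (Localization.AtPrime (extIdeal R σ)))

instance (σ : Type) : Algebra R (Nagata R σ) :=
  inferInstanceAs (Algebra R (Localization.AtPrime (extIdeal R σ)))

instance (σ : Type) : IsScalarTower R (MvPolynomial σ R) (Nagata R σ) :=
  inferInstanceAs (IsScalarTower R (MvPolynomial σ R) (Localization.AtPrime (extIdeal R σ)))

instance (σ : Type) : IsLocalization.AtPrime (Nagata R σ) (extIdeal R σ) :=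
  inferInstanceAs (IsLocalization.AtPrime (Localization.AtPrime (extIdeal R σ)) (extIdeal R σ))

variable {R} {E : Type u} [AddCommGroup E] [Module R E]

/-- The generic elements `x_j = ∑_i z_ij a_i` of `E'' = R'' ⊗ E`, where `R'' = R(Z)` for
`n × s` indeterminates `z_ij`. -/
def genericElement {n s : ℕ} (a : Fin n → E) (j : Fin s) :
    Nagata R (Fin n × Fin s) ⊗[R] E :=
  ∑ i, algebraMap (MvPolynomial (Fin n × Fin s) R) (Nagata R (Fin n × Fin s))
    (MvPolynomial.X (i, j)) ⊗ₜ[R] a i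

/-- The submodule `F` of `E''` generated by the `s` generic elements. -/
def genericSubmodule {n : ℕ} (s : ℕ) (a : Fin n → E) :
    Submodule (Nagata R (Fin n × Fin s)) (Nagata R (Fin n × Fin s) ⊗[R] E) :=
  Submodule.span _ (Set.range (genericElement (s := s) a))

/-- For `E` of rank `e`, the ideal `I` of `R'' = R(Z)` is a generic Bourbaki ideal of `E` with
respect to `U`, constructed from the generators `a 0, …, a (n - 1)` of `U`, where `Z` consists
of `n × (e - 1)` indeterminates: the `R''`-module `E''/F` is isomorphic to `I`. -/
def IsGenericBourbaki (e : ℕ) (U : Submodule R E) {n : ℕ} (a : Fin n → E)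
    (I : Ideal (Nagata R (Fin n × Fin (e - 1)))) : Prop :=
  Submodule.span R (Set.range a) = U ∧
    Nonempty (((Nagata R (Fin n × Fin (e - 1)) ⊗[R] E) ⧸ genericSubmodule (R := R) (e - 1) a)
      ≃ₗ[Nagata R (Fin n × Fin (e - 1))] I)

/-- A good generic Bourbaki ideal is one of grade at least two. -/
def IsGoodGenericBourbaki (e : ℕ) (U : Submodule R E) {n : ℕ} (a : Fin n → E)
    (I : Ideal (Nagata R (Fin n × Fin (e - 1)))) : Prop :=
  IsGenericBourbaki e U a I ∧ 2 ≤ grade I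

end Generic

end Bourbaki

end

-- Embed E in R^e with cokernel of grade at least 2, and extend the embedding to R''. The linear
-- form `volume`, y ↦ det(y, x_1, …, x_{e-1}), takes the value det(a_k, x_1, …, x_{e-1}) at a_k.
-- Once its image has grade at least 2, Cramer's rule shows that its kernel is exactly F
-- (`ker_volume`). Hence E''/F is isomorphic to this image, and a good generic Bourbaki ideal
-- exists.
--
-- The grade bound has two sources. Since U is a reduction, the annihilator of the cokernel lies in
-- the radical of the ideal of maximal minors of the coordinates of the a_i
-- (`mem_radical_minorIdeal`), so these minors generate an ideal of grade at least 2. Where one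
-- minor is invertible, two of the generic determinants have coprime leading monomials with unit
-- coefficients, and so form a regular sequence (`genericMinor_pair`). The bound glues over an ideal
-- of grade at least 2 (`detects_of_forall_away`).
--
-- Now let I be any generic Bourbaki ideal of grade at least 2. Then F is free, and 0 → F → E'' → I
-- → 0 together with faithful flatness of R → R'' gives pd I ≤ 1 iff pd E ≤ 1
-- (`projDim_le_one_iff_of_quotient_equiv`). If I is projective, then it is free and the grade
-- forces I = R'' (`eq_top_of_detects_of_free`), so E is projective; conversely, a free E gives I =
-- R'' (`range_volume_eq_top`). Finally, if pd I = 1, the grade of I cannot exceed 2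
-- (`grade_le_two_of_projDim_le_one`).

universe w

noncomputable section

namespace Bourbaki

/-! ### Grade at least two as a divisibility condition -/

section Grade

variable {A : Type*} [CommRing A]

lemma IsWeaklyRegular.mem_of_mul_mem {rs : List A}
    (h : RingTheory.Sequence.IsWeaklyRegular A rs) (i : ℕ) (hi : i < rs.length) (x : A)
    (hx : rs[i] * x ∈ Ideal.ofList (rs.take i)) : x ∈ Ideal.ofList (rs.take i) := by
  have := (isSMulRegular_quotient_iff_mem_of_smul_mem _ _).1 (h.regular_mod_prev i hi) x
  simpa [hx] using this

lemma isWeaklyRegular_pair_iff {b c : A} :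
    RingTheory.Sequence.IsWeaklyRegular A [b, c] ↔
      (∀ x, b * x = 0 → x = 0) ∧ ∀ x, b ∣ c * x → b ∣ x := by
  rw [RingTheory.Sequence.isWeaklyRegular_iff_Fin]
  simp only [List.length_cons, List.length_nil, Nat.reduceAdd, Fin.forall_fin_two,
    isSMulRegular_quotient_iff_mem_of_smul_mem]
  simp [Ideal.mem_span_singleton]

/-- An ideal detects divisibility if, for `a` zero or a nonzerodivisor, `a` divides `y` as soon as
it divides all multiples of `y` by elements of the ideal. For Noetherian rings this says that the
grade of the ideal is at least two. -/
def Detects (K : Ideal A) : Prop :=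
  ∀ a y : A, (a = 0 ∨ a ∈ A⁰) → (∀ k ∈ K, a ∣ k * y) → a ∣ y

lemma Detects.mono {K L : Ideal A} (h : Detects K) (hKL : K ≤ L) : Detects L :=
  fun a y ha hy => h a y ha fun k hk => hy k (hKL hk)

lemma detects_top : Detects (⊤ : Ideal A) :=
  fun a y _ hy => by simpa using hy 1 trivial

lemma Detects.mul {K L : Ideal A} (hK : Detects K) (hL : Detects L) : Detects (K * L) := by
  intro a y ha hy
  refine hK a y ha fun k hk => hL a _ ha fun l hl => ?_
  have := hy (k * l) (Ideal.mul_mem_mul hk hl)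
  rwa [mul_comm k l, mul_assoc] at this

lemma Detects.pow {K : Ideal A} (hK : Detects K) (n : ℕ) : Detects (K ^ n) := by
  induction n with
  | zero => simpa using detects_top
  | succ n ih => rw [pow_succ]; exact ih.mul hK

/-- From by = au and cy = av with a a nonzerodivisor one gets cu = bv, so b divides u and can be
cancelled. -/
lemma detects_of_pair {K : Ideal A} {b c : A} (hb : b ∈ K) (hc : c ∈ K)
    (h1 : ∀ x, b * x = 0 → x = 0) (h2 : ∀ x, b ∣ c * x → b ∣ x) : Detects K := by
  rintro a y (rfl | ha) hy
  · rw [zero_dvd_iff]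
    exact h1 _ (zero_dvd_iff.1 (hy b hb))
  · obtain ⟨u, hu⟩ := hy b hb
    obtain ⟨v, hv⟩ := hy c hc
    have h3 : c * u = b * v := by
      have : a * (c * u) = a * (b * v) := by linear_combination b * hv - c * hu
      exact (mul_cancel_left_mem_nonZeroDivisors ha).1 this
    obtain ⟨w, rfl⟩ := h2 u ⟨v, h3⟩
    have : b * (y - a * w) = 0 := by linear_combination hu
    exact ⟨w, sub_eq_zero.1 (h1 _ this)⟩

/-- Prime avoidance: `K` consists of zero divisors on `M`, so it lies in one of the finitely many
associated primes, which is the annihilator of an element. -/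
lemma exists_ne_zero_of_forall_not_isSMulRegular [IsNoetherianRing A] (M : Type*)
    [AddCommGroup M] [Module A M] [Module.Finite A M] (K : Ideal A)
    (h : ∀ k ∈ K, ∃ m : M, m ≠ 0 ∧ k • m = 0) : ∃ m : M, m ≠ 0 ∧ ∀ k ∈ K, k • m = 0 := by
  have hsub : (K : Set A) ⊆ ⋃ p ∈ associatedPrimes A M, ((id p : Ideal A) : Set A) := by
    simp only [id]
    rw [biUnion_associatedPrimes_eq_zero_divisors]
    exact h
  obtain ⟨P, hP, hKP⟩ := (Ideal.subset_union_prime_finite (associatedPrimes.finite A M)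
    (f := id) 0 0 fun _ h _ _ => h.isPrime).1 hsub
  obtain ⟨hprime, x, rfl⟩ := isAssociatedPrime_iff.1 hP
  refine ⟨x, fun hx => hprime.ne_top (by simp [hx]), fun k hk => ?_⟩
  simpa [Submodule.mem_colon_singleton] using hKP hk

/-- Prime avoidance on `A`, against the test a = 0, yields b; prime avoidance on A/b, against the
test a = b, yields c. -/
lemma Detects.exists_pair [IsNoetherianRing A] {K : Ideal A} (hK : Detects K) :
    ∃ b ∈ K, ∃ c ∈ K, (∀ x, b * x = 0 → x = 0) ∧ ∀ x, b ∣ c * x → b ∣ x := by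
  obtain ⟨b, hb, hb'⟩ : ∃ b ∈ K, ∀ x, b * x = 0 → x = 0 := by
    by_contra! hcon
    obtain ⟨m, hm, hm'⟩ := exists_ne_zero_of_forall_not_isSMulRegular A K
      fun k hk => let ⟨x, h1, h2⟩ := hcon k hk; ⟨x, h2, h1⟩
    exact hm (zero_dvd_iff.1 (hK 0 m (.inl rfl) fun k hk => zero_dvd_iff.2 (hm' k hk)))
  refine ⟨b, hb, ?_⟩
  by_contra! hcon
  obtain ⟨m, hm, hm'⟩ := exists_ne_zero_of_forall_not_isSMulRegular (A ⧸ Ideal.span {b}) K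
    fun k hk => by
      obtain ⟨x, h1, h2⟩ := hcon k hk hb'
      refine ⟨Ideal.Quotient.mk _ x, ?_, ?_⟩
      · rwa [Ne, Ideal.Quotient.eq_zero_iff_mem, Ideal.mem_span_singleton]
      · change Ideal.Quotient.mk _ (k * x) = 0
        rwa [Ideal.Quotient.eq_zero_iff_mem, Ideal.mem_span_singleton]
  obtain ⟨y, rfl⟩ := Ideal.Quotient.mk_surjective m
  rw [Ne, Ideal.Quotient.eq_zero_iff_mem, Ideal.mem_span_singleton] at hm
  refine hm (hK b y (.inr ?_) fun k hk => ?_)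
  · rw [mem_nonZeroDivisors_iff_right]
    exact fun x hx => hb' x (by rwa [mul_comm])
  · have : Ideal.Quotient.mk _ (k * y) = 0 := hm' k hk
    rwa [Ideal.Quotient.eq_zero_iff_mem, Ideal.mem_span_singleton] at this

lemma Detects.two_le_grade {A : Type u} [CommRing A] [IsNoetherianRing A] {K : Ideal A}
    (hK : Detects K) : 2 ≤ grade K := by
  obtain ⟨b, hb, c, hc, h⟩ := hK.exists_pair
  refine le_iSup₂_of_le (f := fun (rs : List A) (_ : (∀ r ∈ rs, r ∈ K) ∧
    RingTheory.Sequence.IsWeaklyRegular A rs) => (rs.length : ℕ∞)) [b, c]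
    ⟨by simp [hb, hc], isWeaklyRegular_pair_iff.2 h⟩ (by simp)

lemma exists_of_le_grade {A : Type u} [CommRing A] {K : Ideal A} {n : ℕ}
    (h : (n : ℕ∞) ≤ grade K) : ∃ rs : List A, (∀ r ∈ rs, r ∈ K) ∧
      RingTheory.Sequence.IsWeaklyRegular A rs ∧ n ≤ rs.length := by
  rcases n with _ | n
  · exact ⟨[], by simp⟩
  by_contra! hcon
  have : grade K ≤ n := iSup₂_le fun rs hrs => by
    have := hcon rs hrs.1 hrs.2
    exact_mod_cast Nat.lt_succ_iff.1 this
  have := h.trans this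
  norm_cast at this
  omega

lemma detects_of_two_le_grade {A : Type u} [CommRing A] {K : Ideal A} (h : 2 ≤ grade K) :
    Detects K := by
  obtain ⟨rs, h1, h2, h3⟩ := exists_of_le_grade (n := 2) (by exact_mod_cast h)
  match rs, h3 with
  | b :: c :: rs, _ =>
    refine detects_of_pair (h1 b (by simp)) (h1 c (by simp)) (fun x hx => ?_) fun x hx => ?_
    · simpa using IsWeaklyRegular.mem_of_mul_mem h2 0 (by simp) x (by simpa using hx)
    · simpa [Ideal.mem_span_singleton] using
        IsWeaklyRegular.mem_of_mul_mem h2 1 (by simp) x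
          (by simpa [Ideal.mem_span_singleton] using hx)

lemma Detects.map_of_flat [IsNoetherianRing A] {B : Type*} [CommRing B] [Algebra A B]
    [Module.Flat A B] {K : Ideal A} (hK : Detects K) : Detects (K.map (algebraMap A B)) := by
  obtain ⟨b, hb, c, hc, h⟩ := hK.exists_pair
  have := (isWeaklyRegular_pair_iff.2 h).of_flat (S := B)
  have := isWeaklyRegular_pair_iff.1 this
  exact detects_of_pair (Ideal.mem_map_of_mem _ hb) (Ideal.mem_map_of_mem _ hc) this.1 this.2

lemma IsLocalization.Away.exists_dvd_pow_mul {B : Type*} [CommRing B] [Algebra A B] (d : A)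
    [IsLocalization.Away d B] {a y : A} (h : algebraMap A B a ∣ algebraMap A B y) :
    ∃ n : ℕ, a ∣ d ^ n * y := by
  obtain ⟨z, hz⟩ := h
  obtain ⟨⟨u, ⟨_, m, rfl⟩⟩, hu⟩ := IsLocalization.surj (Submonoid.powers d) z
  simp only at hu
  have : algebraMap A B (d ^ m * y) = algebraMap A B (a * u) := by
    rw [map_mul, map_mul, hz, ← hu]; ring
  obtain ⟨⟨_, l, rfl⟩, hl⟩ := (IsLocalization.eq_iff_exists (Submonoid.powers d) B).1 this
  simp only at hl
  exact ⟨l + m, d ^ l * u, by rw [pow_add]; linear_combination hl⟩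

/-- The elements d with a ∣ dy form an ideal. Working over each localization puts a power of every
generator of `D` in it, hence a power of `D`, and powers of `D` still detect divisibility. -/
lemma detects_of_forall_away [IsNoetherianRing A] {K D : Ideal A} (hD : Detects D) {S : Set A}
    (hS : D = Ideal.span S)
    (h : ∀ d ∈ S, ∃ (B : Type w) (_ : CommRing B) (_ : Algebra A B),
      IsLocalization.Away d B ∧ Detects (K.map (algebraMap A B))) : Detects K := by
  intro a y ha hy
  have hle : D ≤ (Ideal.radical (Submodule.comap (LinearMap.mulRight A y) (Ideal.span {a}))) := by
    rw [hS, Ideal.span_le]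
    intro d hd
    obtain ⟨B, _, _, _, h⟩ := h d hd
    have hdvd : algebraMap A B a ∣ algebraMap A B y := by
      refine h _ _ ?_ ?_
      · rcases ha with rfl | ha
        · exact .inl (map_zero _)
        · exact .inr (IsLocalization.map_nonZeroDivisors_le (Submonoid.powers d) _ ⟨a, ha, rfl⟩)
      · intro k hk
        have : K.map (algebraMap A B) ≤
          Submodule.comap (LinearMap.mulRight B (algebraMap A _ y))
            (Ideal.span {algebraMap A B a}) := by
          rw [Ideal.map_le_iff_le_comap]
          intro k hk
          simpa [Ideal.mem_span_singleton] using map_dvd (algebraMap A B)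
            (hy k hk)
        simpa [Ideal.mem_span_singleton] using this hk
    obtain ⟨n, hn⟩ := IsLocalization.Away.exists_dvd_pow_mul d hdvd
    exact ⟨n, by simpa [Ideal.mem_span_singleton] using hn⟩
  obtain ⟨n, hn⟩ := Ideal.exists_pow_le_of_le_radical_of_fg hle (IsNoetherian.noetherian D)
  refine hD.pow n a y ha fun k hk => ?_
  simpa [Ideal.mem_span_singleton] using hn hk

end Grade

/-! ### Leading terms and regular pairs of polynomials -/

section MonomialOrder

open MvPolynomial

variable {σ B : Type*} [CommRing B]

/-- Divide x by f with remainder r. If r ≠ 0 and f divides gr, then the leading monomial of f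
divides that of gr, hence that of r by coprimality, which a remainder does not allow. -/
lemma dvd_of_dvd_mul_of_disjoint_degree (m : MonomialOrder σ) {f g : MvPolynomial σ B}
    (hf : IsUnit (m.leadingCoeff f)) (hg : IsUnit (m.leadingCoeff g))
    (hfg : Disjoint (m.degree f).support (m.degree g).support) {x : MvPolynomial σ B}
    (hx : f ∣ g * x) : f ∣ x := by
  obtain ⟨q, r, rfl, -, hr⟩ := m.div_single hf x
  have hr' : f ∣ g * r := by
    have : g * r = g * (q * f + r) - f * (g * q) := by ring
    rw [this]
    exact dvd_sub hx (dvd_mul_right _ _)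
  suffices r = 0 by simp [this]
  by_contra hr0
  obtain ⟨h, hh⟩ := hr'
  have h0 : h ≠ 0 := by
    rintro rfl
    rw [mul_zero] at hh
    have := m.mem_nonZeroDivisors_of_leadingCoeff_mem_nonZeroDivisors hg.mem_nonZeroDivisors
    exact hr0 ((mul_right_mem_nonZeroDivisors_eq_zero_iff this).1 (by rwa [mul_comm]))
  have hdeg := congrArg m.degree hh
  rw [m.degree_mul_of_left_mem_nonZeroDivisors hg.mem_nonZeroDivisors hr0,
    m.degree_mul_of_left_mem_nonZeroDivisors hf.mem_nonZeroDivisors h0] at hdeg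
  refine hr (m.degree r) (m.degree_mem_support hr0) fun i => ?_
  by_cases hi : i ∈ (m.degree f).support
  · have hig : m.degree g i = 0 := by
      simpa using Finset.disjoint_left.1 hfg hi
    have := DFunLike.congr_fun hdeg i
    simp only [Finsupp.add_apply, hig] at this
    omega
  · rw [Finsupp.notMem_support_iff.1 hi]
    exact Nat.zero_le _

/-- The lexicographic order transported along `κ`: the variable with the smallest `κ`-value is the
most significant. -/
lemma exists_monomialOrder_of_equiv {σ τ : Type w} [LinearOrder τ] [Finite τ] (κ : σ ≃ τ) :
    ∃ m : MonomialOrder.{w, w} σ, ∀ a b : σ →₀ ℕ, ∀ i, a i < b i → (∀ j, κ j < κ i → a j = b j) →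
      m.toSyn a < m.toSyn b := by
  refine ⟨{ syn := (MonomialOrder.lex (σ := τ)).syn
            toSyn := (Finsupp.domCongr κ).trans (MonomialOrder.lex (σ := τ)).toSyn
            toSyn_monotone := fun a b hab => ?_ },
    fun a b i hi hj => ?_⟩
  · have : Finsupp.domCongr κ a ≤ Finsupp.domCongr κ b := fun t => by
      simpa using hab (κ.symm t)
    exact Finsupp.toLex_monotone this
  · change toLex (Finsupp.domCongr κ a) < toLex (Finsupp.domCongr κ b)
    rw [Finsupp.Lex.lt_iff]
    refine ⟨κ i, fun j hj' => ?_, by simpa using hi⟩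
    simpa using hj (κ.symm j) (by simpa using hj')

lemma leadingTerm_of_sum {ι : Type*} [Fintype ι] [DecidableEq ι] (m : MonomialOrder σ)
    (d : ι → σ →₀ ℕ) (c : ι → B) (i₀ : ι) (hc : IsUnit (c i₀))
    (h : ∀ i, i ≠ i₀ → c i ≠ 0 → m.toSyn (d i) < m.toSyn (d i₀)) :
    IsUnit (m.leadingCoeff (∑ i, monomial (d i) (c i))) ∧
      (Nontrivial B → m.degree (∑ i, monomial (d i) (c i)) = d i₀) := by
  rcases subsingleton_or_nontrivial B with _ | hB
  · exact ⟨isUnit_of_subsingleton _, fun h => (not_nontrivial B h).elim⟩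
  have hcoeff : (∑ i, monomial (d i) (c i)).coeff (d i₀) = c i₀ := by
    rw [coeff_sum, Finset.sum_eq_single i₀]
    · classical rw [coeff_monomial, if_pos rfl]
    · classical
      intro i _ hi
      by_cases hci : c i = 0
      · simp [hci]
      · rw [coeff_monomial, if_neg]
        intro h'
        exact (h i hi hci).ne (by rw [h'])
    · simp
  have hdeg : m.degree (∑ i, monomial (d i) (c i)) = d i₀ := by
    apply m.toSyn.injective
    apply le_antisymm
    · refine m.degree_sum_le.trans (Finset.sup_le fun i _ => ?_)
      by_cases hci : c i = 0
      · simp [hci]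
      · refine (m.degree_monomial_le _).trans ?_
        by_cases hi : i = i₀
        · rw [hi]
        · exact (h i hi hci).le
    · apply m.le_degree
      rw [mem_support_iff, hcoeff]
      exact hc.ne_zero
  refine ⟨?_, fun _ => hdeg⟩
  rwa [MonomialOrder.leadingCoeff, hdeg, hcoeff]

end MonomialOrder

/-! ### Leading monomials of the generic determinants -/

section Generic

open MvPolynomial

variable {B : Type*} [CommRing B] {n s : ℕ}

/-- The generic linear combinations of the vectors `v i`. -/
def genericVec (s : ℕ) {N : Type*} (v : Fin n → N → B) (j : Fin s) :
    N → MvPolynomial (Fin n × Fin s) B :=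
  ∑ i, (X (i, j) : MvPolynomial (Fin n × Fin s) B) • (C ∘ v i)

/-- The determinant of `w` and the generic linear combinations of the vectors `v i`, for
`w = v k`. -/
def genericMinor (v : Fin n → Fin (s + 1) → B) (k : Fin n) : MvPolynomial (Fin n × Fin s) B :=
  Matrix.det (Matrix.of (Matrix.vecCons (C ∘ v k) (genericVec s v)))

/-- The exponent of the monomial `∏ j, X (r j, j)`. -/
def choiceExponent (r : Fin s → Fin n) : Fin n × Fin s →₀ ℕ :=
  ∑ j, Finsupp.single (r j, j) 1

lemma choiceExponent_apply (r : Fin s → Fin n) (i : Fin n) (j : Fin s) :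
    choiceExponent r (i, j) = if r j = i then 1 else 0 := by
  simp only [choiceExponent, Finsupp.coe_finsetSum, Finset.sum_apply, Finsupp.single_apply,
    Prod.mk.injEq]
  rw [Finset.sum_eq_single j] <;> simp +contextual

/-- Multilinear expansion in the generic rows: `r` records which vector is chosen in each of them.
-/
lemma genericMinor_eq_sum (v : Fin n → Fin (s + 1) → B) (k : Fin n) :
    genericMinor v k = ∑ r : Fin s → Fin n, monomial (choiceExponent r)
      (Matrix.det (Matrix.of fun t => v ((Matrix.vecCons k r : Fin (s + 1) → Fin n) t))) := by
  have h := ((Matrix.detRowAlternating (n := Fin (s + 1))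
    (R := MvPolynomial (Fin n × Fin s) B)).curryLeft (C ∘ v k)).toMultilinearMap.map_sum
    (fun (j : Fin s) (i : Fin n) =>
      (X (i, j) : MvPolynomial (Fin n × Fin s) B) • (C ∘ v i : Fin (s + 1) → _))
  change genericMinor v k = _ at h
  rw [h]
  refine Finset.sum_congr rfl fun r _ => ?_
  rw [MultilinearMap.map_smul_univ]
  have h1 : (∏ j, X (r j, j) : MvPolynomial (Fin n × Fin s) B) =
      monomial (choiceExponent r) 1 := by
    rw [choiceExponent, monomial_sum_one]
    rfl
  have h2 : ((Matrix.detRowAlternating (n := Fin (s + 1))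
      (R := MvPolynomial (Fin n × Fin s) B)).curryLeft (C ∘ v k)).toMultilinearMap
      (fun j => C ∘ v (r j)) =
      C (Matrix.det (Matrix.of fun t => v ((Matrix.vecCons k r : Fin (s + 1) → Fin n) t))) := by
    rw [RingHom.map_det]
    change Matrix.det (Matrix.of (Matrix.vecCons _ _)) = _
    congr 1
    ext i j
    refine Fin.cases ?_ (fun i => ?_) i <;> simp
  rw [h1, h2, smul_eq_mul, mul_comm, C_mul_monomial, mul_one]

/-- Renumbers the indices so that those of an invertible minor come first, in order; this determines
the term order on the variables. -/
lemma exists_perm_extending_castLE {t : ℕ} (p : Fin t → Fin n) (hp : Function.Injective p) :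
    ∃ κ : Equiv.Perm (Fin n), ∀ j, (κ (p j) : ℕ) = j := by
  have htn : t ≤ n := by simpa using Fintype.card_le_of_injective p hp
  let e : {x // x ∈ Set.range p} ≃ {x // x ∈ Set.range (Fin.castLE htn)} :=
    (Equiv.ofInjective p hp).symm.trans (Equiv.ofInjective _ (Fin.castLE_injective htn))
  refine ⟨e.extendSubtype, fun j => ?_⟩
  rw [e.extendSubtype_apply_of_mem _ ⟨j, rfl⟩]
  have : (Equiv.ofInjective p hp).symm ⟨p j, ⟨j, rfl⟩⟩ = j :=
    (Equiv.symm_apply_eq _).2 rfl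
  simp [e, this]

/-- With variables ordered by (κ i, j), the choice p ∘ i.succAbove dominates every other choice
whose determinant has no repeated row. The witness is its variable in the first column j where the
two choices differ. -/
lemma exists_lt_of_ne_succAbove (p : Fin (s + 1) → Fin n) (κ : Equiv.Perm (Fin n))
    (hκ : ∀ j, (κ (p j) : ℕ) = j) (i : Fin (s + 1)) (r : Fin s → Fin n)
    (hinj : Function.Injective (Matrix.vecCons (p i) r : Fin (s + 1) → Fin n))
    (hr : r ≠ p ∘ i.succAbove) :
    ∃ x : Fin n × Fin s, choiceExponent r x < choiceExponent (p ∘ i.succAbove) x ∧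
      ∀ y : Fin n × Fin s, toLex (κ y.1, y.2) < toLex (κ x.1, x.2) →
        choiceExponent r y = choiceExponent (p ∘ i.succAbove) y := by
  obtain ⟨j, hj, hmin⟩ : ∃ j, r j ≠ p (i.succAbove j) ∧
      ∀ l < j, r l = p (i.succAbove l) := by
    obtain ⟨j, hj⟩ := Function.ne_iff.1 hr
    obtain ⟨j, hj, hmin⟩ := WellFounded.has_min (wellFounded_lt (α := Fin s))
      {j | r j ≠ p (i.succAbove j)} ⟨j, hj⟩
    exact ⟨j, hj, fun l hl => by_contra fun h => hmin l h hl⟩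
  have hrinj : Function.Injective r := fun a b hab => by
    have := @hinj a.succ b.succ (by simpa using hab)
    simpa using this
  refine ⟨(p (i.succAbove j), j), by simp [choiceExponent_apply, hj], ?_⟩
  rintro ⟨i', l⟩ hlt
  simp only [choiceExponent_apply, Function.comp_apply]
  rw [Prod.Lex.toLex_lt_toLex] at hlt
  rcases lt_or_ge l j with hl | hl
  · rw [hmin l hl]
  -- For l ≥ j both exponents vanish at (i', l). If r l = i', then r l = p t with t below
  -- i.succAbove j, so p t is either the row p i or some r l' with l' < j: a repetition in both
  -- cases.
  have hlt' : κ i' < κ (p (i.succAbove j)) := hlt.resolve_right fun h => h.2.not_ge hl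
  rw [Fin.lt_def, hκ] at hlt'
  rw [if_neg, if_neg]
  · rintro rfl
    rw [hκ, ← Fin.lt_def, Fin.succAbove_lt_succAbove_iff] at hlt'
    exact hl.not_gt hlt'
  · rintro rfl
    obtain ⟨t, ht⟩ : ∃ t, p t = r l := by
      refine ⟨⟨κ (r l), hlt'.trans (Fin.is_lt _)⟩, ?_⟩
      apply κ.injective
      apply Fin.ext
      rw [hκ]
    rw [← ht, hκ, ← Fin.lt_def] at hlt'
    rcases Fin.eq_self_or_eq_succAbove i t with rfl | ⟨l', rfl⟩
    · have := @hinj 0 l.succ (by simpa using ht)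
      exact (Fin.succ_ne_zero l this.symm).elim
    · rw [Fin.succAbove_lt_succAbove_iff] at hlt'
      have := hrinj ((hmin l' hlt').trans ht)
      exact (this ▸ hlt').not_ge hl

lemma isUnit_det_vecCons_succAbove (v : Fin n → Fin (s + 1) → B) (p : Fin (s + 1) → Fin n)
    (hp : IsUnit (Matrix.det (Matrix.of fun t => v (p t)))) (i : Fin (s + 1)) :
    IsUnit (Matrix.det (Matrix.of fun t =>
      v ((Matrix.vecCons (p i) (p ∘ i.succAbove) : Fin (s + 1) → Fin n) t))) := by
  have hbij : Function.Bijective (Fin.cons i i.succAbove : Fin (s + 1) → Fin (s + 1)) := by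
    rw [← Finite.injective_iff_bijective, Fin.cons_injective_iff]
    exact ⟨by simp, Fin.succAbove_right_injective⟩
  have : (Matrix.of fun t =>
      v ((Matrix.vecCons (p i) (p ∘ i.succAbove) : Fin (s + 1) → Fin n) t)) =
      (Matrix.of fun t => v (p t)).submatrix (Equiv.ofBijective _ hbij) id := by
    ext t j
    refine Fin.cases ?_ (fun t => ?_) t <;> simp
  rw [this, Matrix.det_permute]
  refine IsUnit.mul ?_ hp
  exact (Units.isUnit (Equiv.Perm.sign (Equiv.ofBijective _ hbij))).map (Int.castRingHom B)

/-- The leading monomials are ∏ X(p (j+1), j) for p 0 and ∏ X(p j, j) for the last index. They share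
no variable because p is injective, and their coefficients are the given unit up to sign. -/
lemma genericMinor_pair (v : Fin n → Fin (s + 1) → B) (p : Fin (s + 1) → Fin n)
    (hp : IsUnit (Matrix.det (Matrix.of fun t => v (p t)))) :
    (∀ x, genericMinor v (p 0) * x = 0 → x = 0) ∧
      ∀ x, genericMinor v (p 0) ∣ genericMinor v (p (Fin.last s)) * x →
        genericMinor v (p 0) ∣ x := by
  rcases subsingleton_or_nontrivial B with _ | hB
  · have : Subsingleton (MvPolynomial (Fin n × Fin s) B) := inferInstance
    exact ⟨fun x _ => Subsingleton.elim _ _, fun x _ => ⟨0, Subsingleton.elim _ _⟩⟩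
  have hdet0 : ∀ q : Fin (s + 1) → Fin n, Matrix.det (Matrix.of fun t => v (q t)) ≠ 0 →
      Function.Injective q := by
    intro q hq a b hab
    by_contra hne
    exact hq (Matrix.det_zero_of_row_eq hne (by ext; simp [hab]))
  obtain ⟨κ, hκ⟩ := exists_perm_extending_castLE p (hdet0 p hp.ne_zero)
  obtain ⟨m, hm⟩ := exists_monomialOrder_of_equiv
    ((κ.prodCongr (Equiv.refl (Fin s))).trans (toLex : Fin n × Fin s ≃ Fin n ×ₗ Fin s))
  have key (i : Fin (s + 1)) : IsUnit (m.leadingCoeff (genericMinor v (p i))) ∧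
      m.degree (genericMinor v (p i)) = choiceExponent (p ∘ i.succAbove) := by
    rw [genericMinor_eq_sum]
    have := leadingTerm_of_sum m choiceExponent (fun r => Matrix.det (Matrix.of fun t =>
      v ((Matrix.vecCons (p i) r : Fin (s + 1) → Fin n) t))) (p ∘ i.succAbove)
      (isUnit_det_vecCons_succAbove v p hp i) fun r hr hc => by
        obtain ⟨x, h1, h2⟩ := exists_lt_of_ne_succAbove p κ hκ i r (hdet0 _ hc) hr
        exact hm _ _ x h1 h2
    exact ⟨this.1, this.2 hB⟩
  refine ⟨fun x hx => ?_, fun x hx => dvd_of_dvd_mul_of_disjoint_degree m (key 0).1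
    (key (Fin.last s)).1 ?_ hx⟩
  · have := m.mem_nonZeroDivisors_of_leadingCoeff_mem_nonZeroDivisors (key 0).1.mem_nonZeroDivisors
    exact (mul_right_mem_nonZeroDivisors_eq_zero_iff this).1 (by rwa [mul_comm])
  · rw [(key _).2, (key _).2, Finset.disjoint_left]
    rintro ⟨i, j⟩ h1 h2
    simp only [Finsupp.mem_support_iff, choiceExponent_apply, Function.comp_apply, ne_eq,
      ite_eq_right_iff, one_ne_zero, imp_false, not_not, Fin.succAbove_zero,
      Fin.succAbove_last] at h1 h2
    have := hdet0 p hp.ne_zero (h1.trans h2.symm)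
    simp [Fin.ext_iff] at this

end Generic

/-! ### Ideals of maximal minors -/

section Minors

/-- The ideal of maximal minors of the matrix with rows `v i`. -/
def minorIdeal {R : Type*} [CommRing R] {n m : ℕ} (v : Fin n → Fin m → R) : Ideal R :=
  Ideal.span (Set.range fun p : Fin m → Fin n => Matrix.det (Matrix.of fun t => v (p t)))

lemma map_genericMinor {R B : Type*} [CommRing R] [CommRing B] (φ : R →+* B) {n s : ℕ}
    (v : Fin n → Fin (s + 1) → R) (k : Fin n) :
    MvPolynomial.map φ (genericMinor v k) = genericMinor (fun i => φ ∘ v i) k := by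
  rw [genericMinor, genericMinor, RingHom.map_det]
  congr 1
  ext i j
  refine Fin.cases ?_ (fun i => ?_) i <;> simp [genericVec, MvPolynomial.map_X]

/-- After inverting a maximal minor d of `v`, `genericMinor_pair` supplies a regular pair; the
minors generate an ideal of grade at least two, over which the property glues. -/
lemma detects_span_genericMinor {R : Type u} [CommRing R] [IsNoetherianRing R] {n s : ℕ}
    (v : Fin n → Fin (s + 1) → R) (h : Detects (minorIdeal v)) :
    Detects (Ideal.span (Set.range (genericMinor v))) := by
  have h1 := h.map_of_flat (B := MvPolynomial (Fin n × Fin s) R)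
  refine detects_of_forall_away.{u, u} h1 (Ideal.map_span _ _) ?_
  rintro _ ⟨_, ⟨p, rfl⟩, rfl⟩
  set d := Matrix.det (Matrix.of fun t => v (p t)) with hd
  let : Algebra (MvPolynomial (Fin n × Fin s) R)
    (MvPolynomial (Fin n × Fin s) (Localization.Away d)) :=
    MvPolynomial.algebraMvPolynomial
  refine ⟨MvPolynomial (Fin n × Fin s) (Localization.Away d), inferInstance, inferInstance, ?_, ?_⟩
  · have := MvPolynomial.isLocalization (σ := Fin n × Fin s) (Submonoid.powers d)
      (Localization.Away d)
    rw [Submonoid.map_powers] at this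
    exact this
  · have hmap (k : Fin n) : genericMinor (fun i => algebraMap R (Localization.Away d) ∘ v i) k ∈
        (Ideal.span (Set.range (genericMinor v))).map
          (algebraMap (MvPolynomial (Fin n × Fin s) R)
            (MvPolynomial (Fin n × Fin s) (Localization.Away d))) := by
      rw [← map_genericMinor]
      exact Ideal.mem_map_of_mem _ (Ideal.subset_span ⟨k, rfl⟩)
    have hu : IsUnit (Matrix.det (Matrix.of fun t =>
        (fun i => algebraMap R (Localization.Away d) ∘ v i) (p t))) := by
      have : (algebraMap R (Localization.Away d)).mapMatrix (Matrix.of fun t => v (p t)) =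
        Matrix.of fun t => (fun i => algebraMap R (Localization.Away d) ∘ v i) (p t) := rfl
      rw [← this, ← RingHom.map_det]
      exact IsLocalization.Away.algebraMap_isUnit d
    obtain ⟨h2, h3⟩ := genericMinor_pair (fun i => algebraMap R (Localization.Away d) ∘ v i) p hu
    exact detects_of_pair (hmap _) (hmap _) h2 h3

lemma exists_linearMap_ne_zero_of_det_eq_zero {K : Type*} [Field K] {n m : ℕ}
    (v : Fin n → Fin m → K)
    (h : ∀ p : Fin m → Fin n, Matrix.det (Matrix.of fun t => v (p t)) = 0) :
    ∃ l : (Fin m → K) →ₗ[K] K, l ≠ 0 ∧ ∀ i, l (v i) = 0 := by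
  have hlt : Submodule.span K (Set.range v) < ⊤ := by
    rw [lt_top_iff_ne_top]
    intro htop
    obtain ⟨g, hg1, -, hg2⟩ := Submodule.exists_fun_fin_finrank_span_eq K (Set.range v)
    have hfin : Module.finrank K (Submodule.span K (Set.range v)) = m := by
      rw [htop, finrank_top, Module.finrank_fin_fun]
    choose p hp using hg1
    obtain ⟨e⟩ : Nonempty (Fin m ≃ Fin (Module.finrank K (Submodule.span K (Set.range v)))) :=
      ⟨finCongr hfin.symm⟩
    have h1 : LinearIndependent K (Matrix.of fun t => v (p (e t))).row := by
      have h2 : (Matrix.of fun t => v (p (e t))).row = g ∘ e := by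
        ext t
        simp [Matrix.row, hp]
      rw [h2]
      exact hg2.comp e e.injective
    rw [Matrix.linearIndependent_rows_iff_isUnit, Matrix.isUnit_iff_isUnit_det,
      h (fun t => p (e t))] at h1
    exact not_isUnit_zero h1
  obtain ⟨l, hl, hle⟩ := Submodule.exists_le_ker_of_lt_top _ hlt
  exact ⟨l, hl, fun i => hle (Submodule.subset_span ⟨i, rfl⟩)⟩

end Minors

/-! ### Maximal minors of a reduction -/

section Reduction

variable {R : Type u} [CommRing R] {E : Type u} [AddCommGroup E] [Module R E]

/-- `f` maps the symmetric algebra to R[X_1, …, X_m], which has no `R`-torsion, so evaluation at `q`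
factors through the Rees algebra. -/
lemma exists_reesAlg_lift {m : ℕ} {K : Type*} [CommRing K] [Algebra R K]
    (f : E →ₗ[R] (Fin m → R)) (q : Fin m → K) :
    ∃ Ψ : ReesAlg R E →ₐ[R] K, ∀ x, Ψ (toRees R E x) = ∑ i, algebraMap R K (f x i) * q i := by
  let φ₁ : E →ₗ[R] MvPolynomial (Fin m) R :=
    (∑ i, (LinearMap.toSpanSingleton R _ (MvPolynomial.X i)).comp (LinearMap.proj i)) ∘ₗ f
  let φ : SymmetricAlgebra R E →ₐ[R] MvPolynomial (Fin m) R := SymmetricAlgebra.lift φ₁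
  have hφ : ∀ x, x ∈ symTorsion R E → (MvPolynomial.aeval q).comp φ x = 0 := by
    rintro x ⟨⟨a, ha⟩, hx⟩
    have hx' : a • x = 0 := hx
    have h1 : MvPolynomial.C a * φ x = 0 := by
      rw [← MvPolynomial.smul_eq_C_mul, ← map_smul, hx', map_zero]
    have h2 : φ x = 0 := by
      ext d
      have := congrArg (MvPolynomial.coeff d) h1
      rw [MvPolynomial.coeff_C_mul, MvPolynomial.coeff_zero] at this
      exact (mul_right_mem_nonZeroDivisors_eq_zero_iff ha).1 (by rwa [mul_comm])
    rw [AlgHom.comp_apply, h2, map_zero]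
  refine ⟨Ideal.Quotient.liftₐ (symTorsion R E) _ hφ, fun x => ?_⟩
  have : Ideal.Quotient.liftₐ (symTorsion R E) _ hφ (toRees R E x) =
    MvPolynomial.aeval q (φ (SymmetricAlgebra.ι R E x)) := rfl
  rw [this, SymmetricAlgebra.lift_ι_apply]
  simp [φ₁, Algebra.smul_def]

/-- At a prime containing all the minors but not c, the generators of `U` lie in a hyperplane l = 0
over the residue field. The algebra map induced by l on the Rees algebra kills `U`, hence the
(r+1)-st power of each element of `E`, hence `E`. But the image of `E` contains c times each basis
vector, so l = 0. -/
lemma mem_radical_minorIdeal {n m : ℕ} {U : Submodule R E} (hU : IsReduction U) {a : Fin n → E}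
    (ha : Submodule.span R (Set.range a) = U) (f : E →ₗ[R] (Fin m → R)) {c : R}
    (hc : ∀ w : Fin m → R, c • w ∈ LinearMap.range f) :
    c ∈ (minorIdeal fun i => f (a i)).radical := by
  rw [Ideal.radical_eq_sInf, Ideal.mem_sInf]
  rintro p ⟨hDp, hp⟩
  by_contra hcp
  let K := p.ResidueField
  have hdet (t : Fin m → Fin n) :
      Matrix.det (Matrix.of fun i => (fun j => algebraMap R K ∘ f (a j)) (t i)) = 0 := by
    have : (algebraMap R K).mapMatrix (Matrix.of fun i => f (a (t i))) =
      Matrix.of fun i => (fun j => algebraMap R K ∘ f (a j)) (t i) := rfl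
    rw [← this, ← RingHom.map_det]
    exact Ideal.algebraMap_residueField_eq_zero.2 (hDp (Ideal.subset_span ⟨t, rfl⟩))
  obtain ⟨l, hl0, hl⟩ := exists_linearMap_ne_zero_of_det_eq_zero
    (fun j => algebraMap R K ∘ f (a j)) hdet
  obtain ⟨Ψ, hΨ⟩ := exists_reesAlg_lift f (fun i => l (Pi.single i 1))
  have hlsum (x : E) : Ψ (toRees R E x) = l (algebraMap R K ∘ f x) := by
    rw [hΨ, LinearMap.pi_apply_eq_sum_univ l (algebraMap R K ∘ f x)]
    refine Finset.sum_congr rfl fun i _ => ?_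
    rw [smul_eq_mul]
    congr 2
    ext j
    simp [Pi.single_apply, eq_comm]
  have hUzero : ∀ x ∈ U, Ψ (toRees R E x) = 0 := by
    have : U ≤ LinearMap.ker (Ψ.toLinearMap ∘ₗ toRees R E) := by
      rw [← ha, Submodule.span_le]
      rintro _ ⟨i, rfl⟩
      exact (hlsum (a i)).trans (hl i)
    exact this
  obtain ⟨r, hr⟩ := hU
  have hEzero (x : E) : Ψ (toRees R E x) = 0 := by
    have h1 : toRees R E x ^ (r + 1) ∈ LinearMap.range (toRees R E) ^ (r + 1) :=
      Submodule.pow_mem_pow _ (LinearMap.mem_range_self _ x) _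
    rw [hr] at h1
    have h2 : U.map (toRees R E) * LinearMap.range (toRees R E) ^ r ≤
        LinearMap.ker Ψ.toLinearMap := by
      rw [Submodule.mul_le]
      rintro _ ⟨y, hy, rfl⟩ z -
      rw [LinearMap.mem_ker, AlgHom.toLinearMap_apply, map_mul, hUzero y hy, zero_mul]
    have h3 : Ψ (toRees R E x ^ (r + 1)) = 0 := h2 h1
    rw [map_pow] at h3
    exact pow_eq_zero_iff (Nat.succ_ne_zero r) |>.1 h3
  apply hl0
  refine LinearMap.pi_ext' fun i => LinearMap.ext_ring ?_
  obtain ⟨x, hx⟩ := hc (Pi.single i 1)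
  have h4 := (hlsum x).symm.trans (hEzero x)
  have h5 : algebraMap R K ∘ f x = algebraMap R K c • Pi.single i 1 := by
    ext j
    rw [hx]
    by_cases hj : j = i
    · subst hj; simp
    · simp [hj]
  rw [h5, map_smul, smul_eq_mul, mul_eq_zero] at h4
  exact h4.resolve_left fun h => hcp (Ideal.algebraMap_residueField_eq_zero.1 h)

lemma detects_minorIdeal [IsNoetherianRing R] {n m : ℕ} {U : Submodule R E} (hU : IsReduction U)
    {a : Fin n → E} (ha : Submodule.span R (Set.range a) = U) (f : E →ₗ[R] (Fin m → R))
    (hf : Detects (Module.annihilator R ((Fin m → R) ⧸ LinearMap.range f))) :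
    Detects (minorIdeal fun i => f (a i)) := by
  obtain ⟨N, hN⟩ := Ideal.exists_pow_le_of_le_radical_of_fg
    (I := Module.annihilator R ((Fin m → R) ⧸ LinearMap.range f))
    (J := minorIdeal fun i => f (a i)) (fun c hc => mem_radical_minorIdeal hU ha f fun w => by
      have := Module.mem_annihilator.1 hc (Submodule.Quotient.mk w)
      rwa [← Submodule.Quotient.mk_smul, Submodule.Quotient.mk_eq_zero] at this)
    (IsNoetherian.noetherian _)
  exact (hf.pow N).mono hN

end Reduction

/-! ### The determinantal linear form and its kernel -/

section Volume

variable {A : Type*} [CommRing A] {M : Type*} [AddCommGroup M] [Module A M] {s : ℕ}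

/-- The matrix with columns `g y, g (x 0), …, g (x (s - 1))`. -/
def colMatrix (g : M →ₗ[A] (Fin (s + 1) → A)) (x : Fin s → M) (y : M) :
    Matrix (Fin (s + 1)) (Fin (s + 1)) A :=
  (Matrix.of (Matrix.vecCons (g y) (g ∘ x))).transpose

/-- The linear form `y ↦ det (y, x 0, …, x (s - 1))`. -/
def volume (g : M →ₗ[A] (Fin (s + 1) → A)) (x : Fin s → M) : M →ₗ[A] A where
  toFun y := Matrix.detRowAlternating.curryLeft (g y) (g ∘ x)
  map_add' y z := by simp only [map_add, AlternatingMap.add_apply]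
  map_smul' c y := by simp only [map_smul, AlternatingMap.smul_apply, RingHom.id_apply]

lemma volume_apply (g : M →ₗ[A] (Fin (s + 1) → A)) (x : Fin s → M) (y : M) :
    volume g x y = Matrix.det (Matrix.of (Matrix.vecCons (g y) (g ∘ x))) := rfl

lemma det_colMatrix (g : M →ₗ[A] (Fin (s + 1) → A)) (x : Fin s → M) (y : M) :
    (colMatrix g x y).det = volume g x y := by
  rw [colMatrix, Matrix.det_transpose, volume_apply]

lemma colMatrix_mulVec (g : M →ₗ[A] (Fin (s + 1) → A)) (x : Fin s → M) (y : M)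
    (u : Fin (s + 1) → A) :
    (colMatrix g x y).mulVec u = g (u 0 • y + ∑ j, u j.succ • x j) := by
  ext i
  simp [colMatrix, Matrix.mulVec, dotProduct, Fin.sum_univ_succ, mul_comm]

lemma linearIndependent_of_volume_mem {g : M →ₗ[A] (Fin (s + 1) → A)} {x : Fin s → M} {y : M}
    (h : volume g x y ∈ A⁰) : LinearIndependent A x := by
  rw [Fintype.linearIndependent_iff]
  intro c hc j
  have h1 := colMatrix_mulVec g x y (Matrix.vecCons 0 c)
  simp only [Matrix.cons_val_zero, zero_smul, Matrix.cons_val_succ, hc, add_zero, map_zero] at h1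
  have h2 := congrArg (colMatrix g x y).adjugate.mulVec h1
  rw [Matrix.mulVec_mulVec, Matrix.adjugate_mul, det_colMatrix, Matrix.smul_mulVec,
    Matrix.one_mulVec, Matrix.mulVec_zero] at h2
  have h3 := congrFun h2 j.succ
  simp only [Pi.smul_apply, Matrix.cons_val_succ, smul_eq_mul, Pi.zero_apply] at h3
  exact (mul_right_mem_nonZeroDivisors_eq_zero_iff h).1 (by rwa [mul_comm])

lemma volume_apply_self (g : M →ₗ[A] (Fin (s + 1) → A)) (x : Fin s → M) (j : Fin s) :
    volume g x (x j) = 0 := by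
  rw [volume_apply]
  refine Matrix.det_zero_of_row_eq (i := 0) (j := j.succ) (Fin.succ_ne_zero j).symm ?_
  ext
  simp

lemma exists_volume_smul_eq {g : M →ₗ[A] (Fin (s + 1) → A)} (hg : Function.Injective g)
    (x : Fin s → M) (y z : M) (hz : volume g x z = 0) :
    ∃ c : Fin s → A, volume g x y • z = ∑ j, c j • x j := by
  have h1 := Matrix.mulVec_cramer (colMatrix g x y) (g z)
  have h0 : Matrix.cramer (colMatrix g x y) (g z) 0 = 0 := by
    rw [Matrix.cramer_apply, ← hz, volume_apply, ← Matrix.det_transpose]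
    congr 1
    ext i j
    refine Fin.cases ?_ (fun i => ?_) i <;> simp [colMatrix]
  rw [colMatrix_mulVec, h0, zero_smul, zero_add, det_colMatrix, ← map_smul] at h1
  exact ⟨_, (hg h1).symm⟩

/-- For z in the kernel, Cramer's rule writes volume(y) z = ∑ c_j x_j. Comparing with the same
relation for w and using independence of the x_j, volume(y) divides volume(w) c_j for all w, hence
divides c_j; then volume(y) cancels. -/
lemma ker_volume [IsNoetherianRing A] {g : M →ₗ[A] (Fin (s + 1) → A)}
    (hg : Function.Injective g) (x : Fin s → M)
    (hd : Detects (LinearMap.range (volume g x) : Ideal A)) :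
    LinearMap.ker (volume g x) = Submodule.span A (Set.range x) := by
  apply le_antisymm
  · intro z hz
    obtain ⟨a, ⟨y, rfl⟩, -, -, ha, -⟩ := hd.exists_pair
    have ha' : volume g x y ∈ A⁰ := by
      rw [mem_nonZeroDivisors_iff_right]
      exact fun t ht => ha t (by rwa [mul_comm])
    have hli := linearIndependent_of_volume_mem ha'
    obtain ⟨c, hc⟩ := exists_volume_smul_eq hg x y z hz
    have hdvd (j : Fin s) : volume g x y ∣ c j := by
      refine hd _ _ (.inr ha') ?_
      rintro _ ⟨w, rfl⟩
      obtain ⟨c', hc'⟩ := exists_volume_smul_eq hg x w z hz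
      have h1 : ∑ i, (volume g x w * c i) • x i = ∑ i, (volume g x y * c' i) • x i := by
        simp only [mul_smul, ← Finset.smul_sum, ← hc, ← hc']
        rw [smul_comm]
      exact ⟨c' j, Fintype.linearIndependent_iffₛ.1 hli _ _ h1 j⟩
    choose d hd' using hdvd
    have h2 : z = ∑ j, d j • x j := by
      apply hg
      ext i
      have h3 := congrFun (congrArg g hc) i
      simp only [hd', mul_smul, ← Finset.smul_sum, map_smul, Pi.smul_apply, smul_eq_mul] at h3
      exact (mul_cancel_left_mem_nonZeroDivisors ha').1 h3
    rw [h2]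
    exact Submodule.sum_mem _ fun j _ => Submodule.smul_mem _ _ (Submodule.subset_span ⟨j, rfl⟩)
  · rw [Submodule.span_le]
    rintro _ ⟨j, rfl⟩
    exact volume_apply_self g x j

/-- Let y lie over b. If z lies over t, then bz and ty have the same image bt in `I`, so bM is
contained in the span of y and the x_j. In coordinates, the matrix of y and the x_j therefore
divides bc times the identity, and its determinant volume(y) is a nonzerodivisor. -/
lemma linearIndependent_of_quotient_equiv_ideal (g : M →ₗ[A] (Fin (s + 1) → A)) (x : Fin s → M)
    {c : A} (hc : c ∈ A⁰) (hcg : ∀ w : Fin (s + 1) → A, c • w ∈ LinearMap.range g)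
    (I : Ideal A) (φ : (M ⧸ Submodule.span A (Set.range x)) ≃ₗ[A] I) {b : A} (hb : b ∈ I)
    (hb' : b ∈ A⁰) : LinearIndependent A x := by
  obtain ⟨y, hy⟩ := Submodule.Quotient.mk_surjective _ (φ.symm ⟨b, hb⟩)
  apply linearIndependent_of_volume_mem (g := g) (y := y)
  have h1 (z : M) : ∃ u : Fin (s + 1) → A, b • z = u 0 • y + ∑ j, u j.succ • x j := by
    set t := φ (Submodule.Quotient.mk z) with ht
    have h2 : b • z - (t : A) • y ∈ Submodule.span A (Set.range x) := by
      rw [← Submodule.Quotient.mk_eq_zero, ← φ.map_eq_zero_iff, Submodule.Quotient.mk_sub,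
        Submodule.Quotient.mk_smul, Submodule.Quotient.mk_smul, hy, map_sub, map_smul, map_smul,
        φ.apply_symm_apply, ← ht]
      ext
      simp [mul_comm]
    obtain ⟨d, hd⟩ := (Submodule.mem_span_range_iff_exists_fun A).1 h2
    exact ⟨Matrix.vecCons (t : A) d, by simp [hd]⟩
  choose z hz using fun i : Fin (s + 1) => hcg (Pi.single i 1)
  choose u hu using fun i => h1 (z i)
  have h3 : colMatrix g x y * (Matrix.of u).transpose = (b * c) • (1 : Matrix _ _ A) := by
    ext i j
    have h4 := congrFun (colMatrix_mulVec g x y (u j)) i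
    rw [← hu, map_smul, hz] at h4
    rw [Matrix.mul_apply]
    refine Eq.trans ?_ (h4.trans ?_)
    · rfl
    · simp [Matrix.one_apply, Pi.single_apply]
  have h5 := congrArg Matrix.det h3
  rw [Matrix.det_mul, det_colMatrix, Matrix.det_smul, Matrix.det_one, mul_one] at h5
  have h6 := pow_mem (mul_mem hb' hc) (Fintype.card (Fin (s + 1)))
  rw [← h5] at h6
  exact (mul_mem_nonZeroDivisors.1 h6).1

end Volume

/-! ### Projective dimension in short exact sequences and under base change -/

section ProjDim

open CategoryTheory

variable {A : Type u} [CommRing A]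

lemma projDim_le_iff (M : Type u) [AddCommGroup M] [Module A M] (n : ℕ) :
    projDim A M ≤ n ↔ HasProjectiveDimensionLT (ModuleCat.of A M) (n + 1) :=
  projectiveDimension_le_iff _ _

lemma projDim_le_of_lt_succ {M : Type u} [AddCommGroup M] [Module A M] {n : ℕ}
    (h : projDim A M < (n + 1 : ℕ)) : projDim A M ≤ n :=
  (projDim_le_iff M n).2 (projectiveDimension_lt_iff.1 h)

lemma projDim_le_zero_iff (M : Type u) [AddCommGroup M] [Module A M] :
    projDim A M ≤ (0 : ℕ) ↔ Module.Projective A M := by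
  rw [projDim_le_iff, IsProjective.iff_projective, projective_iff_hasProjectiveDimensionLT_one]

variable {M₁ M₂ M₃ : Type u} [AddCommGroup M₁] [Module A M₁] [AddCommGroup M₂] [Module A M₂]
  [AddCommGroup M₃] [Module A M₃]

lemma exists_shortExact {f : M₁ →ₗ[A] M₂} {g : M₂ →ₗ[A] M₃} (hf : Function.Injective f)
    (hfg : Function.Exact f g) (hg : Function.Surjective g) :
    ∃ h, (ShortComplex.mk (ModuleCat.ofHom f) (ModuleCat.ofHom g) h).ShortExact := by
  have h : ModuleCat.ofHom f ≫ ModuleCat.ofHom g = 0 := by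
    rw [← ModuleCat.ofHom_comp, hfg.linearMap_comp_eq_zero]
    rfl
  refine ⟨h, ?_⟩
  exact ModuleCat.shortComplex_shortExact _ hfg hf hg

lemma projDim_middle_le {f : M₁ →ₗ[A] M₂} {g : M₂ →ₗ[A] M₃} (hf : Function.Injective f)
    (hfg : Function.Exact f g) (hg : Function.Surjective g) (n : ℕ) (h₁ : projDim A M₁ ≤ n)
    (h₃ : projDim A M₃ ≤ n) : projDim A M₂ ≤ n := by
  obtain ⟨_, hS⟩ := exists_shortExact hf hfg hg
  rw [projDim_le_iff] at h₁ h₃ ⊢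
  exact hS.hasProjectiveDimensionLT_X₂ _ h₁ h₃

lemma projDim_right_le {f : M₁ →ₗ[A] M₂} {g : M₂ →ₗ[A] M₃} (hf : Function.Injective f)
    (hfg : Function.Exact f g) (hg : Function.Surjective g) (n : ℕ) (h₁ : projDim A M₁ ≤ n)
    (h₂ : projDim A M₂ ≤ (n + 1 : ℕ)) : projDim A M₃ ≤ (n + 1 : ℕ) := by
  obtain ⟨_, hS⟩ := exists_shortExact hf hfg hg
  rw [projDim_le_iff] at h₁ h₂ ⊢
  exact hS.hasProjectiveDimensionLT_X₃ _ h₁ h₂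

lemma projDim_right_le_succ_iff [Module.Projective A M₂] {f : M₁ →ₗ[A] M₂} {g : M₂ →ₗ[A] M₃}
    (hf : Function.Injective f) (hfg : Function.Exact f g) (hg : Function.Surjective g) (n : ℕ) :
    projDim A M₃ ≤ (n + 1 : ℕ) ↔ projDim A M₁ ≤ n := by
  obtain ⟨_, hS⟩ := exists_shortExact hf hfg hg
  rw [projDim_le_iff, projDim_le_iff]
  exact hS.hasProjectiveDimensionLT_X₃_iff n ((IsProjective.iff_projective M₂).1 inferInstance)

lemma projDim_quotient_le_succ_iff (I : Ideal A) (n : ℕ) :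
    projDim A (A ⧸ I) ≤ (n + 1 : ℕ) ↔ projDim A I ≤ n :=
  projDim_right_le_succ_iff (f := Submodule.subtype I) (g := Submodule.mkQ I)
    (Submodule.subtype_injective I)
    (LinearMap.exact_subtype_mkQ I) (Submodule.mkQ_surjective I) n

lemma projDim_quotient_ideal_top : projDim A (A ⧸ (⊤ : Ideal A)) = ⊥ := by
  have : Subsingleton (A ⧸ (⊤ : Ideal A)) := inferInstance
  exact (projectiveDimension_eq_bot_iff _).2 (ModuleCat.isZero_of_subsingleton _)

/-- The condition says that a first syzygy is projective, which for finitely presented modules means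
flat, and flatness descends along faithfully flat maps. -/
lemma projDim_baseChange_le_one_iff [IsNoetherianRing A] (B : Type u) [CommRing B] [Algebra A B]
    [Module.FaithfullyFlat A B] (E : Type u) [AddCommGroup E] [Module A E]
    [Module.Finite A E] : projDim B (B ⊗[A] E) ≤ (1 : ℕ) ↔ projDim A E ≤ (1 : ℕ) := by
  obtain ⟨m, π, hπ⟩ := Module.Finite.exists_fin' A E
  let K := LinearMap.ker π
  have hex : Function.Exact K.subtype π := LinearMap.exact_subtype_ker_map π
  have h1 := projDim_right_le_succ_iff K.subtype_injective hex hπ 0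
  have h2 := projDim_right_le_succ_iff (A := B) (f := K.subtype.baseChange B)
    (g := π.baseChange B) (Module.Flat.lTensor_preserves_injective_linearMap _ K.subtype_injective)
    (lTensor_exact B hex hπ) (LinearMap.lTensor_surjective B hπ) 0
  rw [zero_add, projDim_le_zero_iff] at h1 h2
  rw [h1, h2]
  have : Module.FinitePresentation A K := Module.finitePresentation_of_finite A K
  constructor
  · intro h
    have := Module.Flat.of_flat_tensorProduct (R := A) (M := K) B
    exact Module.Flat.projective_of_finitePresentation
  · intro h
    infer_instance

end ProjDim

/-! ### Bounding the grade by the projective dimension -/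

section GradeBound

variable {A : Type*} [CommRing A]

/-- Any two elements x, y of an ideal satisfy the relation x · y = y · x, so a basis has at most one
element. That generator is a nonzerodivisor dividing all of `I`, hence dividing 1. -/
lemma eq_top_of_detects_of_free [Nontrivial A] {I : Ideal A} (hI : Detects I)
    [Module.Free A I] : I = ⊤ := by
  let b := Module.Free.chooseBasis A I
  have hcomm (x y : I) : (x : A) • y = (y : A) • x := Subtype.ext (mul_comm _ _)
  have hsub : Subsingleton (Module.Free.ChooseBasisIndex A I) := by
    refine ⟨fun i j => by_contra fun hij => b.ne_zero j ?_⟩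
    have h1 := congrArg (fun x => b.repr x i) (hcomm (b i) (b j))
    refine Subtype.ext (Eq.symm ?_)
    simpa [Finsupp.single_apply, hij, Ne.symm hij, eq_comm] using h1
  have hne : Nonempty (Module.Free.ChooseBasisIndex A I) := by
    by_contra hemp
    rw [not_nonempty_iff] at hemp
    have : Subsingleton I := b.repr.toEquiv.subsingleton
    have h1 := hI 0 1 (.inl rfl) fun k hk => by
      have : (⟨k, hk⟩ : I) = 0 := Subsingleton.elim _ _
      have : k = 0 := congrArg Subtype.val this
      simp [this]
    exact one_ne_zero (zero_dvd_iff.1 h1)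
  obtain ⟨i⟩ := hne
  have := Fintype.ofSubsingleton i
  have hreg : (b i : A) ∈ A⁰ := by
    rw [mem_nonZeroDivisors_iff_right]
    intro y hy
    have h1 : y • b i = 0 := Subtype.ext hy
    simpa using congrArg (fun x => b.repr x i) h1
  have hdvd : (b i : A) ∣ 1 := hI _ _ (.inr hreg) fun k hk => by
    have h1 := b.sum_repr ⟨k, hk⟩
    rw [Fintype.sum_subsingleton _ i] at h1
    refine ⟨b.repr ⟨k, hk⟩ i, ?_⟩
    have h2 : b.repr ⟨k, hk⟩ i * (b i : A) = k := congrArg Subtype.val h1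
    rw [mul_one, mul_comm, h2]
  exact I.eq_top_of_isUnit_mem (b i).2 (isUnit_of_dvd_one hdvd)

/-- A linear form on the first syzygy of `I` extends, if `I` contains a weakly regular sequence of
length three. -/
lemma exists_extension_of_regular {I : Ideal A} {P N : Type*} [AddCommGroup P] [Module A P]
    [AddCommGroup N] [Module A N] [Module.Projective A P] {d : N →ₗ[A] P} {π : P →ₗ[A] A}
    (hd : Function.Injective d) (hdπ : Function.Exact d π) (hπ : LinearMap.range π = I)
    {r₁ r₂ r₃ : A} (h₁ : r₁ ∈ I) (h₂ : r₂ ∈ I) (h₃ : r₃ ∈ I) (hr₁ : ∀ x, r₁ * x = 0 → x = 0)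
    (hr₂ : ∀ x, r₁ ∣ r₂ * x → r₁ ∣ x)
    (hr₃ : ∀ x, r₃ * x ∈ Ideal.span {r₁, r₂} → x ∈ Ideal.span {r₁, r₂}) (h : N →ₗ[A] A) :
    ∃ g : P →ₗ[A] A, g ∘ₗ d = h := by
  have hdet : Detects I := detects_of_pair h₁ h₂ hr₁ hr₂
  have hreg : r₁ ∈ A⁰ := by
    rw [mem_nonZeroDivisors_iff_right]
    exact fun x hx => hr₁ x (by rwa [mul_comm])
  -- multiplication by an element of `I` is nullhomotopic on `N → P → A`
  have hk (r : A) (hr : r ∈ I) : ∃ k : P →ₗ[A] A, k ∘ₗ d = r • h := by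
    rw [← hπ] at hr
    obtain ⟨p, rfl⟩ := hr
    let e : N ≃ₗ[A] LinearMap.ker π :=
      LinearEquiv.ofBijective (d.codRestrict _ fun x => hdπ.apply_apply_eq_zero x)
        ⟨fun x y hxy => hd (congrArg Subtype.val hxy), fun ⟨y, hy⟩ => by
          obtain ⟨x, rfl⟩ := (hdπ y).1 hy
          exact ⟨x, rfl⟩⟩
    let k : P →ₗ[A] LinearMap.ker π :=
      (π p • LinearMap.id - π.smulRight p).codRestrict _ fun y => by simp [mul_comm]
    refine ⟨h ∘ₗ e.symm.toLinearMap ∘ₗ k, LinearMap.ext fun x => ?_⟩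
    have : k (d x) = e (π p • x) := by
      ext
      change π p • d x - π (d x) • p = d (π p • x)
      rw [map_smul, hdπ.apply_apply_eq_zero x, zero_smul, sub_zero]
    simp [this]
  -- linear forms vanishing on `N` are multiples of `π`
  have hfac (k : P →ₗ[A] A) (hk : k ∘ₗ d = 0) : ∃ t : A, k = t • π := by
    rw [← hπ] at h₁
    obtain ⟨p, hp⟩ := h₁
    have hsym (x y : P) : π x * k y = π y * k x := by
      have h0 : π (π x • y - π y • x) = 0 := by simp [mul_comm]
      obtain ⟨z, hz⟩ := (hdπ _).1 h0
      have := congrArg k hz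
      rw [← LinearMap.comp_apply, hk, LinearMap.zero_apply] at this
      simp only [map_sub, map_smul, smul_eq_mul] at this
      exact (sub_eq_zero.1 this.symm)
    obtain ⟨t, ht⟩ : r₁ ∣ k p := by
      refine hdet _ _ (.inr hreg) ?_
      rw [← hπ]
      rintro _ ⟨y, rfl⟩
      exact ⟨k y, by rw [← hp, hsym]⟩
    refine ⟨t, LinearMap.ext fun y => ?_⟩
    refine (mul_cancel_left_mem_nonZeroDivisors hreg).1 ?_
    rw [← hp, hsym, ht, hp, LinearMap.smul_apply, smul_eq_mul]
    ring
  obtain ⟨k₁, hk₁⟩ := hk r₁ h₁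
  obtain ⟨k₂, hk₂⟩ := hk r₂ h₂
  obtain ⟨k₃, hk₃⟩ := hk r₃ h₃
  -- Two of the extensions of multiples of h, cross-multiplied, agree on `N`, so they differ by a
  -- multiple of π.
  have hcross (r r' : A) (k k' : P →ₗ[A] A) (h1 : k ∘ₗ d = r • h) (h2 : k' ∘ₗ d = r' • h) :
      ∃ t : A, r' • k - r • k' = t • π := by
    apply hfac
    rw [LinearMap.sub_comp, LinearMap.smul_comp, LinearMap.smul_comp, h1, h2, smul_comm, sub_self]
  obtain ⟨t, ht⟩ := hcross _ _ _ _ hk₁ hk₂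
  obtain ⟨t', ht'⟩ := hcross _ _ _ _ hk₁ hk₃
  obtain ⟨t'', ht''⟩ := hcross _ _ _ _ hk₂ hk₃
  have hrel : r₃ * t = r₂ * t' - r₁ * t'' := by
    rw [← hπ] at h₁
    obtain ⟨p, hp⟩ := h₁
    have e1 := LinearMap.congr_fun ht p
    have e2 := LinearMap.congr_fun ht' p
    have e3 := LinearMap.congr_fun ht'' p
    simp only [LinearMap.sub_apply, LinearMap.smul_apply, smul_eq_mul, hp] at e1 e2 e3
    refine (mul_cancel_left_mem_nonZeroDivisors hreg).1 ?_
    linear_combination -r₃ * e1 + r₂ * e2 - r₁ * e3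
  -- Regularity of r₃ modulo (r₁, r₂) gives t = αr₁ + βr₂, so r₂(k₁ - βπ) = r₁(k₂ + απ). Hence r₁
  -- divides k₁ - βπ, and the quotient is the required extension.
  obtain ⟨α, β, hαβ⟩ := Ideal.mem_span_pair.1 (hr₃ t (by
    rw [hrel, Ideal.mem_span_pair]
    exact ⟨-t'', t', by ring⟩))
  have hdvd (y : P) : r₁ ∣ (k₁ - β • π) y := by
    apply hr₂
    refine ⟨(k₂ + α • π) y, ?_⟩
    have e1 := LinearMap.congr_fun ht y
    simp only [LinearMap.sub_apply, LinearMap.smul_apply, smul_eq_mul, LinearMap.add_apply] at e1 ⊢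
    linear_combination e1 - π y * hαβ
  choose g hg using hdvd
  have hcancel {x y : A} (hxy : r₁ * x = r₁ * y) : x = y :=
    (mul_cancel_left_mem_nonZeroDivisors hreg).1 hxy
  refine ⟨{ toFun := g
            map_add' := fun x y => hcancel ?_
            map_smul' := fun c x => hcancel ?_ }, LinearMap.ext fun x => hcancel ?_⟩
  · rw [mul_add, ← hg, ← hg, ← hg, map_add]
  · rw [RingHom.id_apply, smul_eq_mul, mul_left_comm, ← hg, ← hg, map_smul, smul_eq_mul]
  · have := LinearMap.congr_fun hk₁ x
    simp only [LinearMap.comp_apply, LinearMap.smul_apply, smul_eq_mul] at this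
    change r₁ * g (d x) = _
    rw [← hg, LinearMap.sub_apply, LinearMap.smul_apply, hdπ.apply_apply_eq_zero, smul_zero,
      sub_zero, this]

/-- If the grade were at least three, the coordinate forms of the free first syzygy of `I` would
extend to the ambient free module. They would split the presentation of `I`, making `I` projective.
-/
lemma grade_le_two_of_projDim_le_one {A : Type u} [CommRing A] [IsNoetherianRing A]
    [IsLocalRing A] {I : Ideal A} (hI : projDim A I ≤ (1 : ℕ))
    (hI' : ¬ Module.Projective A I) : grade I ≤ 2 := by
  by_contra hcon
  obtain ⟨rs, hrs1, hrs2, hrs3⟩ := exists_of_le_grade (K := I) (n := 3) (by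
    have := Order.add_one_le_of_lt (not_le.1 hcon)
    exact_mod_cast this)
  match rs, hrs3 with
  | r₁ :: r₂ :: r₃ :: rs, _ =>
    obtain ⟨m, π, hπ⟩ := Module.Finite.exists_fin' A I
    let K := LinearMap.ker π
    have hex : Function.Exact K.subtype π := LinearMap.exact_subtype_ker_map π
    have hK : Module.Projective A K := by
      rw [← projDim_le_zero_iff]
      exact (projDim_right_le_succ_iff K.subtype_injective hex hπ 0).1 hI
    have hKfree : Module.Free A K := Module.free_of_flat_of_isLocalRing
    have hex' : Function.Exact K.subtype (Submodule.subtype I ∘ₗ π) := by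
      intro x
      rw [← hex x]
      simp
    have hrange : LinearMap.range (Submodule.subtype I ∘ₗ π) = I := by
      rw [LinearMap.range_comp, LinearMap.range_eq_top.2 hπ, Submodule.map_top,
        Submodule.range_subtype]
    have hext := exists_extension_of_regular K.subtype_injective hex' hrange
      (hrs1 r₁ (by simp)) (hrs1 r₂ (by simp)) (hrs1 r₃ (by simp))
      (fun x hx => by
        simpa using IsWeaklyRegular.mem_of_mul_mem hrs2 0 (by simp) x (by simpa using hx))
      (fun x hx => by
        simpa [Ideal.mem_span_singleton] using IsWeaklyRegular.mem_of_mul_mem hrs2 1 (by simp) x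
          (by simpa [Ideal.mem_span_singleton] using hx))
      (fun x hx => by
        have h12 : Ideal.ofList ((r₁ :: r₂ :: r₃ :: rs).take 2) = Ideal.span {r₁, r₂} := by
          simp [Ideal.span_insert]
        rw [← h12] at hx ⊢
        exact IsWeaklyRegular.mem_of_mul_mem hrs2 2 (by simp) x hx)
    let b := Module.Free.chooseBasis A K
    choose g hg using fun i => hext (b.coord i)
    let ρ : (Fin m → A) →ₗ[A] K := ∑ i, (g i).smulRight (b i)
    have hρ : ρ ∘ₗ K.subtype = LinearMap.id := by
      ext x : 1
      have h1 (i) : g i x = b.coord i x := LinearMap.congr_fun (hg i) x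
      simp only [ρ, LinearMap.comp_apply, LinearMap.sum_apply, LinearMap.smulRight_apply,
        Submodule.subtype_apply, h1, LinearMap.id_apply]
      exact b.sum_repr x
    have hsplit : (∃ l, l ∘ₗ K.subtype = LinearMap.id) → ∃ l, π ∘ₗ l = LinearMap.id :=
      ((hex.split_tfae K.subtype_injective hπ).out 1 0).1
    obtain ⟨σ, hσ⟩ := hsplit ⟨ρ, hρ⟩
    exact hI' (Module.Projective.of_split σ π hσ)

end GradeBound

/-! ### The Nagata extension is Noetherian local and faithfully flat -/

section Nagata

variable (R : Type u) [CommRing R] [IsLocalRing R] (σ : Type)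

instance : IsLocalRing (Nagata R σ) :=
  IsLocalization.AtPrime.isLocalRing _ (extIdeal R σ)

instance : Module.Flat (MvPolynomial σ R) (Nagata R σ) :=
  IsLocalization.flat _ (extIdeal R σ).primeCompl

instance : Module.Flat R (Nagata R σ) :=
  Module.Flat.trans R (MvPolynomial σ R) (Nagata R σ)

instance [IsNoetherianRing R] [Finite σ] : IsNoetherianRing (Nagata R σ) :=
  IsLocalization.isNoetherianRing (extIdeal R σ).primeCompl _ inferInstance

lemma mem_extIdeal_iff (f : MvPolynomial σ R) :
    f ∈ extIdeal R σ ↔ MvPolynomial.map (IsLocalRing.residue R) f = 0 := by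
  rw [← RingHom.mem_ker, MvPolynomial.ker_map, IsLocalRing.ker_residue]
  rfl

instance : IsLocalHom (algebraMap R (Nagata R σ)) := by
  refine ⟨fun r hr => ?_⟩
  rw [IsScalarTower.algebraMap_apply R (MvPolynomial σ R),
    IsLocalization.AtPrime.isUnit_to_map_iff (Nagata R σ) (extIdeal R σ)] at hr
  by_contra h
  exact hr ((mem_extIdeal_iff R σ _).2 (by
    rw [MvPolynomial.algebraMap_eq, MvPolynomial.map_C,
      (IsLocalRing.residue_eq_zero_iff r).2 ((IsLocalRing.mem_maximalIdeal r).2 h), map_zero]))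

instance : Module.FaithfullyFlat R (Nagata R σ) :=
  Module.FaithfullyFlat.of_flat_of_isLocalHom

end Nagata

/-! ### Coordinates after base change -/

section Coordinates

variable {R : Type u} [CommRing R] {E : Type u} [AddCommGroup E] [Module R E]

/-- The coordinates on `B ⊗ E` induced by a map from `E` to a free module. -/
def coords (B : Type u) [CommRing B] [Algebra R B] {m : ℕ} (f : E →ₗ[R] (Fin m → R)) :
    B ⊗[R] E →ₗ[B] (Fin m → B) :=
  (TensorProduct.piScalarRight R B B (Fin m)).toLinearMap ∘ₗ f.baseChange B

variable (B : Type u) [CommRing B] [Algebra R B] {m : ℕ} (f : E →ₗ[R] (Fin m → R))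

lemma coords_tmul (b : B) (y : E) : coords B f (b ⊗ₜ y) = fun i => f y i • b := by
  simp [coords]

lemma coords_injective [Module.Flat R B] (hf : Function.Injective f) :
    Function.Injective (coords B f) :=
  (TensorProduct.piScalarRight R B B (Fin m)).injective.comp
    (Module.Flat.lTensor_preserves_injective_linearMap f hf)

lemma smul_mem_range_coords {c : R} (hc : ∀ w : Fin m → R, c • w ∈ LinearMap.range f)
    (w : Fin m → B) : algebraMap R B c • w ∈ LinearMap.range (coords B f) := by
  have hw : w = ∑ i, w i • Pi.single i 1 := by
    simpa using (Pi.basisFun B (Fin m)).sum_repr w |>.symm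
  rw [hw, Finset.smul_sum]
  refine Submodule.sum_mem _ fun i _ => ?_
  rw [smul_comm]
  refine Submodule.smul_mem _ _ ?_
  obtain ⟨y, hy⟩ := hc (Pi.single i 1)
  refine ⟨1 ⊗ₜ y, ?_⟩
  rw [coords_tmul, hy]
  ext j
  by_cases hj : j = i
  · subst hj; simp [Algebra.smul_def]
  · simp [hj]

end Coordinates

/-! ### Construction of a good generic Bourbaki ideal -/

section Existence

variable {R : Type u} [CommRing R] [IsLocalRing R] {E : Type u} [AddCommGroup E] [Module R E]
  {n s : ℕ}

lemma coords_genericElement {m : ℕ} (f : E →ₗ[R] (Fin m → R)) (a : Fin n → E) (j : Fin s) :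
    coords (Nagata R (Fin n × Fin s)) f (genericElement a j) =
      algebraMap (MvPolynomial (Fin n × Fin s) R) (Nagata R (Fin n × Fin s)) ∘
        genericVec s (fun i => f (a i)) j := by
  ext t
  simp only [genericElement, map_sum, coords_tmul, genericVec, Finset.sum_apply,
    Function.comp_apply, Pi.smul_apply, smul_eq_mul, map_mul]
  refine Finset.sum_congr rfl fun i _ => ?_
  rw [Algebra.smul_def, mul_comm, IsScalarTower.algebraMap_apply R (MvPolynomial (Fin n × Fin s) R),
    MvPolynomial.algebraMap_eq]

lemma volume_tmul (f : E →ₗ[R] (Fin (s + 1) → R)) (a : Fin n → E) (k : Fin n) :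
    volume (coords (Nagata R (Fin n × Fin s)) f) (genericElement a) (1 ⊗ₜ a k) =
      algebraMap (MvPolynomial (Fin n × Fin s) R) _ (genericMinor (fun i => f (a i)) k) := by
  rw [volume_apply, genericMinor, RingHom.map_det]
  congr 1
  ext i j
  refine Fin.cases ?_ (fun i => ?_) i
  · have h := IsScalarTower.algebraMap_apply R (MvPolynomial (Fin n × Fin s) R)
      (Nagata R (Fin n × Fin s)) (f (a k) j)
    rw [MvPolynomial.algebraMap_eq] at h
    simpa [coords_tmul, Algebra.smul_def] using h
  · simp [coords_genericElement]

lemma detects_range_volume [IsNoetherianRing R] {U : Submodule R E} (hU : IsReduction U) {a : Fin n → E}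
    (ha : Submodule.span R (Set.range a) = U) (f : E →ₗ[R] (Fin (s + 1) → R))
    (hf : Detects (Module.annihilator R ((Fin (s + 1) → R) ⧸ LinearMap.range f))) :
    Detects (LinearMap.range
      (volume (coords (Nagata R (Fin n × Fin s)) f) (genericElement a)) : Ideal _) := by
  refine (detects_span_genericMinor _ (detects_minorIdeal hU ha f hf)).map_of_flat
    (B := Nagata R (Fin n × Fin s)) |>.mono ?_
  rw [Ideal.map_span, Ideal.span_le]
  rintro _ ⟨_, ⟨k, rfl⟩, rfl⟩
  exact ⟨1 ⊗ₜ a k, volume_tmul f a k⟩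

lemma nonempty_quotient_equiv_range_volume [IsNoetherianRing R] {U : Submodule R E} (hU : IsReduction U)
    {a : Fin n → E} (ha : Submodule.span R (Set.range a) = U) (f : E →ₗ[R] (Fin (s + 1) → R))
    (hfinj : Function.Injective f)
    (hf : Detects (Module.annihilator R ((Fin (s + 1) → R) ⧸ LinearMap.range f))) :
    Nonempty (((Nagata R (Fin n × Fin s) ⊗[R] E) ⧸ genericSubmodule (R := R) s a)
      ≃ₗ[Nagata R (Fin n × Fin s)] LinearMap.range
        (volume (coords (Nagata R (Fin n × Fin s)) f) (genericElement a))) := by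
  have h := ker_volume (coords_injective (Nagata R (Fin n × Fin s)) f hfinj)
    (genericElement (s := s) a) (detects_range_volume hU ha f hf)
  exact ⟨(Submodule.quotEquivOfEq _ _ h.symm).trans (LinearMap.quotKerEquivRange _)⟩

/-- When `f` is onto, some maximal minor is a unit of the local ring `R`. A generic determinant is
then nonzero modulo 𝔪, so it becomes a unit in R(Z). -/
lemma range_volume_eq_top {U : Submodule R E} (hU : IsReduction U)
    {a : Fin n → E} (ha : Submodule.span R (Set.range a) = U) (f : E →ₗ[R] (Fin (s + 1) → R))
    (hf : Function.Surjective f) :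
    LinearMap.range (volume (coords (Nagata R (Fin n × Fin s)) f) (genericElement a)) = ⊤ := by
  have h1 := mem_radical_minorIdeal hU ha f (c := 1) fun w => hf _
  rw [← Ideal.eq_top_iff_one, Ideal.radical_eq_top] at h1
  obtain ⟨p, hp⟩ : ∃ p : Fin (s + 1) → Fin n,
      IsUnit (Matrix.det (Matrix.of fun t => f (a (p t)))) := by
    by_contra! hcon
    refine (IsLocalRing.maximalIdeal.isMaximal R).ne_top (top_le_iff.1 (h1.symm.le.trans ?_))
    rw [minorIdeal, Ideal.span_le]
    rintro _ ⟨p, rfl⟩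
    exact (IsLocalRing.mem_maximalIdeal _).2 (hcon p)
  have h2 : genericMinor (fun i => f (a i)) (p 0) ∉ extIdeal R (Fin n × Fin s) := by
    rw [mem_extIdeal_iff, map_genericMinor]
    intro h0
    have h3 := hp.map (IsLocalRing.residue R)
    rw [RingHom.map_det] at h3
    -- Over the residue field the generic determinant is a nonzerodivisor, so it cannot be zero.
    have h4 := (genericMinor_pair (fun i => IsLocalRing.residue R ∘ f (a i)) p h3).1 1
      (by rw [h0, zero_mul])
    exact one_ne_zero h4
  have h5 : IsUnit (algebraMap (MvPolynomial (Fin n × Fin s) R) (Nagata R (Fin n × Fin s))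
      (genericMinor (fun i => f (a i)) (p 0))) :=
    (IsLocalization.AtPrime.isUnit_to_map_iff _ (extIdeal R (Fin n × Fin s)) _).2 h2
  exact Ideal.eq_top_of_isUnit_mem _ ⟨1 ⊗ₜ a (p 0), volume_tmul f a (p 0)⟩ h5

end Existence

/-! ### The rank equals the rank of the ambient free module -/

section Rank

variable {R : Type u} [CommRing R] [Nontrivial R] {E : Type u} [AddCommGroup E] [Module R E]

lemma eq_of_hasRank {e m : ℕ} (h : HasRank R E e) (f : E →ₗ[R] (Fin m → R))
    (hf : Function.Injective f) {c : R} (hc : c ∈ R⁰)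
    (hcf : ∀ w : Fin m → R, c • w ∈ LinearMap.range f) : m = e := by
  obtain ⟨φ⟩ := h
  have : Module.Flat R (FractionRing R) := IsLocalization.flat _ R⁰
  have hbij : Function.Bijective (coords (FractionRing R) f) := by
    refine ⟨coords_injective _ f hf, fun w => ?_⟩
    have hu : IsUnit (algebraMap R (FractionRing R) c) :=
      IsLocalization.map_units (FractionRing R) (⟨c, hc⟩ : R⁰)
    obtain ⟨y, hy⟩ := smul_mem_range_coords (FractionRing R) f hcf (hu.unit⁻¹.val • w)
    refine ⟨y, ?_⟩
    rw [hy, smul_smul, IsUnit.mul_val_inv, one_smul]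
  have := ((LinearEquiv.ofBijective _ hbij).symm.trans φ).finrank_eq
  simpa using this

end Rank

/-! ### Comparison of E with its generic Bourbaki ideals -/

section Main

variable {R : Type u} [CommRing R] [IsLocalRing R] [IsNoetherianRing R]
  {E : Type u} [AddCommGroup E] [Module R E]

/-- An ideal module of rank `e` embeds into a free module of rank `e`. -/
lemma IsIdealModule.exists_embedding (hE : IsIdealModule R E) {e : ℕ} (h : HasRank R E e) :
    ∃ f : E →ₗ[R] (Fin e → R), Function.Injective f ∧
      Detects (Module.annihilator R ((Fin e → R) ⧸ LinearMap.range f)) ∧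
      ∃ c ∈ R⁰, ∀ w : Fin e → R, c • w ∈ LinearMap.range f := by
  obtain ⟨-, m, f, hf, hgr⟩ := hE
  have hd := detects_of_two_le_grade hgr
  obtain ⟨c, hc, -, -, hc', -⟩ := hd.exists_pair
  have hc0 : c ∈ R⁰ := by
    rw [mem_nonZeroDivisors_iff_right]
    exact fun x hx => hc' x (by rwa [mul_comm])
  have hcf (w : Fin m → R) : c • w ∈ LinearMap.range f := by
    have := Module.mem_annihilator.1 hc (Submodule.Quotient.mk w)
    rwa [← Submodule.Quotient.mk_smul, Submodule.Quotient.mk_eq_zero] at this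
  obtain rfl := eq_of_hasRank h f hf hc0 hcf
  exact ⟨f, hf, hd, c, hc0, hcf⟩

lemma linearIndependent_genericElement {n s : ℕ} (f : E →ₗ[R] (Fin (s + 1) → R)) {c : R}
    (hc : c ∈ R⁰) (hcf : ∀ w : Fin (s + 1) → R, c • w ∈ LinearMap.range f) (a : Fin n → E)
    (I : Ideal (Nagata R (Fin n × Fin s)))
    (φ : ((Nagata R (Fin n × Fin s) ⊗[R] E) ⧸ genericSubmodule (R := R) s a)
      ≃ₗ[Nagata R (Fin n × Fin s)] I) (hI : Detects I) :
    LinearIndependent (Nagata R (Fin n × Fin s)) (genericElement (R := R) (s := s) a) := by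
  obtain ⟨b, hb, -, -, hb', -⟩ := hI.exists_pair
  have hb0 : b ∈ (Nagata R (Fin n × Fin s))⁰ := by
    rw [mem_nonZeroDivisors_iff_right]
    exact fun x hx => hb' x (by rwa [mul_comm])
  have hc0 : algebraMap R (Nagata R (Fin n × Fin s)) c ∈ (Nagata R (Fin n × Fin s))⁰ := by
    have h1 : IsSMulRegular R c := isSMulRegular_iff_right_eq_zero_of_smul.2 fun x hx =>
      mem_nonZeroDivisors_iff_right.1 hc x (by rwa [mul_comm])
    have h2 := h1.of_flat (S := Nagata R (Fin n × Fin s))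
    rw [mem_nonZeroDivisors_iff_right]
    exact fun x hx => isSMulRegular_iff_right_eq_zero_of_smul.1 h2 x (by
      rwa [smul_eq_mul, mul_comm])
  exact linearIndependent_of_quotient_equiv_ideal (coords _ f) _ hc0
    (smul_mem_range_coords _ f hcf) I φ hb hb0

variable [Module.Finite R E]

/-- For a generic Bourbaki ideal `I` of grade at least two, the sequence `0 → F → E'' → I → 0` and
the freeness of `F` compare the projective dimensions of `E` and `I`. -/
lemma projDim_le_one_iff_of_quotient_equiv {n s : ℕ} (f : E →ₗ[R] (Fin (s + 1) → R)) {c : R}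
    (hc : c ∈ R⁰) (hcf : ∀ w : Fin (s + 1) → R, c • w ∈ LinearMap.range f) (a : Fin n → E)
    (I : Ideal (Nagata R (Fin n × Fin s)))
    (φ : ((Nagata R (Fin n × Fin s) ⊗[R] E) ⧸ genericSubmodule (R := R) s a)
      ≃ₗ[Nagata R (Fin n × Fin s)] I) (hI : Detects I) :
    projDim (Nagata R (Fin n × Fin s)) I ≤ (1 : ℕ) ↔ projDim R E ≤ (1 : ℕ) := by
  rw [← projDim_baseChange_le_one_iff (Nagata R (Fin n × Fin s)) E]
  let F := genericSubmodule (R := R) s a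
  have hF : Module.Free (Nagata R (Fin n × Fin s)) F :=
    Module.Free.of_basis (Module.Basis.span (linearIndependent_genericElement f hc hcf a I φ hI))
  let g : (Nagata R (Fin n × Fin s) ⊗[R] E) →ₗ[Nagata R (Fin n × Fin s)] I :=
    φ.toLinearMap ∘ₗ F.mkQ
  have hex : Function.Exact F.subtype g := by
    intro x
    simp [g]
  have hg : Function.Surjective g := φ.surjective.comp F.mkQ_surjective
  have hF0 : projDim (Nagata R (Fin n × Fin s)) F ≤ (0 : ℕ) :=
    (projDim_le_zero_iff _).2 inferInstance
  constructor
  · exact projDim_middle_le F.subtype_injective hex hg 1 (hF0.trans (by norm_num))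
  · exact projDim_right_le F.subtype_injective hex hg 0 hF0

/-- Here E'' is an extension of a free module by the free module F, hence projective, and flatness
descends to `E`. -/
lemma projective_of_quotient_equiv_top {n s : ℕ} (f : E →ₗ[R] (Fin (s + 1) → R)) {c : R}
    (hc : c ∈ R⁰) (hcf : ∀ w : Fin (s + 1) → R, c • w ∈ LinearMap.range f) (a : Fin n → E)
    (φ : ((Nagata R (Fin n × Fin s) ⊗[R] E) ⧸ genericSubmodule (R := R) s a)
      ≃ₗ[Nagata R (Fin n × Fin s)] (⊤ : Ideal (Nagata R (Fin n × Fin s)))) :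
    Module.Projective R E := by
  let F := genericSubmodule (R := R) s a
  have hF : Module.Free (Nagata R (Fin n × Fin s)) F :=
    Module.Free.of_basis
      (Module.Basis.span (linearIndependent_genericElement f hc hcf a ⊤ φ detects_top))
  let g : (Nagata R (Fin n × Fin s) ⊗[R] E) →ₗ[Nagata R (Fin n × Fin s)]
      (⊤ : Ideal (Nagata R (Fin n × Fin s))) := φ.toLinearMap ∘ₗ F.mkQ
  have hex : Function.Exact F.subtype g := by
    intro x
    simp [g]
  have hg : Function.Surjective g := φ.surjective.comp F.mkQ_surjective
  have h1 : projDim (Nagata R (Fin n × Fin s)) F ≤ (0 : ℕ) :=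
    (projDim_le_zero_iff _).2 inferInstance
  have h2 : projDim (Nagata R (Fin n × Fin s)) (⊤ : Ideal (Nagata R (Fin n × Fin s))) ≤ (0 : ℕ) :=
    (projDim_le_zero_iff _).2 (Module.Projective.of_equiv Submodule.topEquiv.symm)
  have h3 := (projDim_le_zero_iff _).1 (projDim_middle_le F.subtype_injective hex hg 0 h1 h2)
  have := Module.Flat.of_flat_tensorProduct (R := R) (M := E) (Nagata R (Fin n × Fin s))
  have : Module.FinitePresentation R E := Module.finitePresentation_of_finite R E
  exact Module.Flat.projective_of_finitePresentation

lemma isPerfect_of_projDim_eq_one {n s : ℕ} (f : E →ₗ[R] (Fin (s + 1) → R)) {c : R}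
    (hc : c ∈ R⁰) (hcf : ∀ w : Fin (s + 1) → R, c • w ∈ LinearMap.range f) (a : Fin n → E)
    (I : Ideal (Nagata R (Fin n × Fin s)))
    (φ : ((Nagata R (Fin n × Fin s) ⊗[R] E) ⧸ genericSubmodule (R := R) s a)
      ≃ₗ[Nagata R (Fin n × Fin s)] I) (hI : 2 ≤ grade I) (hE : projDim R E = 1) :
    IsPerfect I ∧ grade I = 2 := by
  have hd := detects_of_two_le_grade hI
  have hI1 := (projDim_le_one_iff_of_quotient_equiv f hc hcf a I φ hd).2 hE.le
  have hproj : ¬ Module.Projective (Nagata R (Fin n × Fin s)) I := by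
    intro h
    have : Module.Free (Nagata R (Fin n × Fin s)) I := Module.free_of_flat_of_isLocalRing
    obtain rfl := eq_top_of_detects_of_free hd
    have h1 := (projDim_le_zero_iff (A := R) E).2 (projective_of_quotient_equiv_top f hc hcf a φ)
    rw [hE] at h1
    exact absurd h1 (by norm_num)
  have hgr : grade I = 2 := le_antisymm (grade_le_two_of_projDim_le_one hI1 hproj) hI
  refine ⟨?_, hgr⟩
  rw [IsPerfect, hgr]
  refine le_antisymm ((projDim_quotient_le_succ_iff I 1).2 hI1) ?_
  by_contra hlt
  exact hproj ((projDim_le_zero_iff _).1 ((projDim_quotient_le_succ_iff I 0).1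
    (projDim_le_of_lt_succ (not_le.1 hlt))))

lemma projDim_eq_one_of_isPerfect {n s : ℕ} (hrank : HasRank R E (s + 1)) {U : Submodule R E}
    (hU : IsReduction U) (f : E →ₗ[R] (Fin (s + 1) → R)) {c : R}
    (hc : c ∈ R⁰) (hcf : ∀ w : Fin (s + 1) → R, c • w ∈ LinearMap.range f) (a : Fin n → E)
    (ha : Submodule.span R (Set.range a) = U) (I : Ideal (Nagata R (Fin n × Fin s)))
    (φ : ((Nagata R (Fin n × Fin s) ⊗[R] E) ⧸ genericSubmodule (R := R) s a)
      ≃ₗ[Nagata R (Fin n × Fin s)] I) (hI : IsPerfect I) (hgr : grade I = 2) :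
    projDim R E = 1 := by
  have hd := detects_of_two_le_grade hgr.ge
  have hpd : projDim (Nagata R (Fin n × Fin s)) (Nagata R (Fin n × Fin s) ⧸ I) = (2 : ℕ∞) := by
    rw [← hgr]
    exact hI
  have h1 := (projDim_le_one_iff_of_quotient_equiv f hc hcf a I φ hd).1
    ((projDim_quotient_le_succ_iff I 1).1 hpd.le)
  refine le_antisymm h1 ?_
  by_contra hlt
  have h0 : projDim R E ≤ (0 : ℕ) := projDim_le_of_lt_succ (not_le.1 hlt)
  have hproj := (projDim_le_zero_iff _).1 h0
  have hfree : Module.Free R E := Module.free_of_flat_of_isLocalRing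
  let b := Module.finBasis R E
  have hrk : Module.finrank R E = s + 1 :=
    eq_of_hasRank hrank b.equivFun.toLinearMap b.equivFun.injective (one_mem _)
      fun w => by simp
  let b' := b.reindex (finCongr hrk)
  -- The quotient E''/F depends only on a, so it may be computed with the coordinates of a basis of
  -- `E`; this identifies it with R'', and `I` is free.
  obtain ⟨ψ⟩ := nonempty_quotient_equiv_range_volume (s := s) hU ha b'.equivFun.toLinearMap
    b'.equivFun.injective (by
      rw [LinearEquiv.range]
      have : Subsingleton ((Fin (s + 1) → R) ⧸ (⊤ : Submodule R (Fin (s + 1) → R))) := inferInstance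
      rw [Module.annihilator_eq_top_iff.2 this]
      exact detects_top)
  rw [range_volume_eq_top hU ha _ b'.equivFun.surjective] at ψ
  have : Module.Free (Nagata R (Fin n × Fin s)) I :=
    Module.Free.of_equiv ((Submodule.topEquiv.symm.trans ψ.symm).trans φ)
  obtain rfl := eq_top_of_detects_of_free hd
  -- The zero module R''/I has projective dimension `⊥`, not 2.
  rw [projDim_quotient_ideal_top] at hpd
  exact absurd hpd (by simp)

end Main

end Bourbaki

end

theorem proposition5p5 {R : Type u} [CommRing R] [IsNoetherianRing R] [IsLocalRing R]
    {E : Type u} [AddCommGroup E] [Module R E] (hE : Bourbaki.IsIdealModule R E)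
    (e : ℕ) (he : 2 ≤ e) (hrank : Bourbaki.HasRank R E e)
    (U : Submodule R E) (hU : Bourbaki.IsReduction U) :
    [ Bourbaki.projDim R E = 1,
      ∀ (n : ℕ) (a : Fin n → E) (I : Ideal (Bourbaki.Nagata R (Fin n × Fin (e - 1)))),
        Bourbaki.IsGoodGenericBourbaki e U a I →
          Bourbaki.IsPerfect I ∧ Bourbaki.grade I = 2,
      ∃ (n : ℕ) (a : Fin n → E) (I : Ideal (Bourbaki.Nagata R (Fin n × Fin (e - 1)))),
        Bourbaki.IsGenericBourbaki e U a I ∧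
          Bourbaki.IsPerfect I ∧ Bourbaki.grade I = 2 ].TFAE := by
  have hfin := hE.1
  -- With e = s + 1 the number e - 1 of generic elements reduces definitionally to s.
  obtain ⟨s, rfl⟩ : ∃ s, e = s + 1 := ⟨e - 1, by omega⟩
  obtain ⟨f, hf, hd, c, hc, hcf⟩ := hE.exists_embedding hrank
  tfae_have 1 → 2 := by
    rintro h1 n a I ⟨⟨-, ⟨φ⟩⟩, hI⟩
    exact Bourbaki.isPerfect_of_projDim_eq_one f hc hcf a I φ hI h1
  tfae_have 2 → 3 := by
    intro h2
    -- Condition 2 could hold vacuously, so a good ideal must be produced: the image of `volume`.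
    obtain ⟨n, a, ha⟩ := Submodule.fg_iff_exists_fin_generating_family.1
      (IsNoetherian.noetherian U)
    obtain ⟨φ⟩ := Bourbaki.nonempty_quotient_equiv_range_volume (s := s) hU ha f hf hd
    have hI := (Bourbaki.detects_range_volume (s := s) hU ha f hd).two_le_grade
    exact ⟨n, a, _, ⟨ha, ⟨φ⟩⟩, h2 n a _ ⟨⟨ha, ⟨φ⟩⟩, hI⟩⟩
  tfae_have 3 → 1 := by
    rintro ⟨n, a, I, ⟨ha, ⟨φ⟩⟩, hI, hgr⟩
    exact Bourbaki.projDim_eq_one_of_isPerfect hrank hU f hc hcf a ha I φ hI hgr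
  tfae_finish
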